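/- Let $N\ge 2$, $\rho_\pm>0$, $V_\pm>0$, $\gamma\ge 0$. Put $\mathbb R^N_-=\{x_1<0\}$, $\mathbb R^N_+=\{x_1>0\}$, $\Sigma=\{x_1=0\}$, and for $\Omega\subset\mathbb R^N$ let $\Omega_\pm=\Omega\cap\mathbb R^N_\pm$, $\Gamma_\pm=\partial\Omega\cap\mathbb R^N_\pm$, $\Gamma_0=\partial\Omega\cap\Sigma$. Consider the problem $$\min\{\mathcal F(\Omega):\ \Omega\subset\mathbb R^N\text{ of finite perimeter},\ \rho_-|\Omega_-|=V_-,\ \rho_+|\Omega_+|=V_+\},$$ $$\mathcal F(\Omega)=\rho_-P(\Omega,\mathbb R^N_-)+\rho_+P(\Omega,\mathbb R^N_+)+\gamma\,\mathcal H^{N-1}(\Gamma_0),$$ where $P(\Omega,U)$ is the relative perimeter of De Giorgi and $\mathcal H^{N-1}$ the Hausdorff measure. A minimizer $\Omega$ of this problem is of type I if $\Omega$ is connected, $\Gamma_-$ and $\Gamma_+$ are spherical caps (a spherical cap being the part, in the open half-space, of a sphere that crosses $\Sigma$) whose boundaries as manifolds coincide, and $\overline\Omega\cap\Sigma$ is an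 $(N-1)$-dimensional ball. For $\alpha\in[0,\pi)$, $\beta\in(0,\pi]$ and $R_\pm>0$ let $$\Omega(\alpha,\beta,R_\pm)=\bigl(\overline B(-R_-\cos\alpha\,e_1,\,R_-)\cap\{x_1\le 0\}\bigr)\cup\bigl(\overline B(-R_+\cos\beta\,e_1,\,R_+)\cap\{x_1\ge 0\}\bigr).$$ **Theorem (Snell's law for type I minimizers).** If $\Omega(\alpha,\beta,R_\pm)$ is a type I minimizer, then $$\rho_-\cos\alpha=\rho_+\cos\beta.$$ -/

import Mathlib

open MeasureTheory Metric
open scoped ENNReal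

noncomputable section

namespace TwoPhase

variable {N : ℕ} [NeZero N]

/-- The open left half-space `{x₁ < 0}` of `ℝᴺ` (the first coordinate has index `0`). -/
def leftHalf (N : ℕ) [NeZero N] : Set (EuclideanSpace ℝ (Fin N)) := {x | x 0 < 0}

/-- The open right half-space `{x₁ > 0}`. -/
def rightHalf (N : ℕ) [NeZero N] : Set (EuclideanSpace ℝ (Fin N)) := {x | 0 < x 0}

/-- The interface hyperplane `{x₁ = 0}`. -/
def interface (N : ℕ) [NeZero N] : Set (EuclideanSpace ℝ (Fin N)) := {x | x 0 = 0}

/-- The divergence of a vector field on `ℝᴺ`. -/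
def divergence (φ : EuclideanSpace ℝ (Fin N) → EuclideanSpace ℝ (Fin N))
    (x : EuclideanSpace ℝ (Fin N)) : ℝ :=
  ∑ i : Fin N, (fderiv ℝ φ x (EuclideanSpace.single i 1)) i

/-- The relative perimeter `P(E, U)` in the sense of De Giorgi: the supremum of `∫_E div φ` over
the vector fields `φ ∈ C¹_c(U; ℝᴺ)` with `|φ| ≤ 1` everywhere. -/
def perimeter (E U : Set (EuclideanSpace ℝ (Fin N))) : ℝ≥0∞ :=
  ⨆ (φ : EuclideanSpace ℝ (Fin N) → EuclideanSpace ℝ (Fin N)) (_ : ContDiff ℝ 1 φ)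
    (_ : HasCompactSupport φ) (_ : tsupport φ ⊆ U) (_ : ∀ x, ‖φ x‖ ≤ 1),
    ENNReal.ofReal (∫ x in E, divergence φ x)

/-- Sets of finite perimeter in `ℝᴺ`. -/
def HasFinitePerimeter (E : Set (EuclideanSpace ℝ (Fin N))) : Prop :=
  NullMeasurableSet E volume ∧ perimeter E Set.univ < ∞

/-- `Γ₋ = ∂Ω ∩ {x₁ < 0}`, with the topological boundary. -/
def bdryLeft (S : Set (EuclideanSpace ℝ (Fin N))) : Set (EuclideanSpace ℝ (Fin N)) :=
  frontier S ∩ leftHalf N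

/-- `Γ₊ = ∂Ω ∩ {x₁ > 0}`. -/
def bdryRight (S : Set (EuclideanSpace ℝ (Fin N))) : Set (EuclideanSpace ℝ (Fin N)) :=
  frontier S ∩ rightHalf N

/-- `Γ₀ = ∂Ω ∩ {x₁ = 0}`. -/
def bdryInterface (S : Set (EuclideanSpace ℝ (Fin N))) : Set (EuclideanSpace ℝ (Fin N)) :=
  frontier S ∩ interface N

/-- The weighted perimeter
`F(Ω) = ρ₋ P(Ω, {x₁ < 0}) + ρ₊ P(Ω, {x₁ > 0}) + γ H^{N-1}(Γ₀)`. Here `μHE[N - 1]` is the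
`(N-1)`-dimensional Hausdorff measure in its usual (Lebesgue) normalization. -/
def weightedPerimeter (ρm ρp γ : ℝ) (S : Set (EuclideanSpace ℝ (Fin N))) : ℝ≥0∞ :=
  ENNReal.ofReal ρm * perimeter S (leftHalf N) + ENNReal.ofReal ρp * perimeter S (rightHalf N)
    + ENNReal.ofReal γ * μHE[N - 1] (bdryInterface S)

/-- The admissible sets: finite perimeter, `ρ₋ |Ω₋| = V₋` and `ρ₊ |Ω₊| = V₊`. -/
def IsAdmissible (ρm ρp Vm Vp : ℝ) (S : Set (EuclideanSpace ℝ (Fin N))) : Prop :=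
  HasFinitePerimeter S ∧
    ENNReal.ofReal ρm * volume (S ∩ leftHalf N) = ENNReal.ofReal Vm ∧
    ENNReal.ofReal ρp * volume (S ∩ rightHalf N) = ENNReal.ofReal Vp

/-- Minimizers of the weighted perimeter among all admissible sets. -/
def IsMinimizer (ρm ρp γ Vm Vp : ℝ) (S : Set (EuclideanSpace ℝ (Fin N))) : Prop :=
  IsAdmissible ρm ρp Vm Vp S ∧
    ∀ T : Set (EuclideanSpace ℝ (Fin N)), IsAdmissible ρm ρp Vm Vp T →
      weightedPerimeter ρm ρp γ S ≤ weightedPerimeter ρm ρp γ T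

/-- `G` is a spherical cap in the open half-space `H` (the left or the right one): the part in `H`
of a sphere that crosses the interface. Whole spheres are not caps. -/
def IsSphericalCap (H G : Set (EuclideanSpace ℝ (Fin N))) : Prop :=
  ∃ (c : EuclideanSpace ℝ (Fin N)) (R : ℝ), |c 0| < R ∧ G = sphere c R ∩ H

/-- The boundary of a spherical cap as a manifold with boundary (the cap itself being
relatively open in its sphere): the limit points that do not belong to it. -/
def manifoldBoundary (G : Set (EuclideanSpace ℝ (Fin N))) : Set (EuclideanSpace ℝ (Fin N)) :=
  closure G \ G

/-- Type I minimizers: connected minimizers for which `Γ₋` and `Γ₊` are spherical caps with the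
same boundary and `closure Ω ∩ {x₁ = 0}` is an `(N-1)`-dimensional ball. -/
structure IsTypeIMinimizer (ρm ρp γ Vm Vp : ℝ) (S : Set (EuclideanSpace ℝ (Fin N))) : Prop where
  isMinimizer : IsMinimizer ρm ρp γ Vm Vp S
  isConnected : IsConnected S
  cap_left : IsSphericalCap (leftHalf N) (bdryLeft S)
  cap_right : IsSphericalCap (rightHalf N) (bdryRight S)
  boundary_eq : manifoldBoundary (bdryLeft S) = manifoldBoundary (bdryRight S)
  ball_interface : ∃ c ∈ interface N, ∃ r : ℝ, 0 < r ∧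
    closure S ∩ interface N = closedBall c r ∩ interface N

/-- The axially symmetric candidate set `Ω(α, β, R₋, R₊)`: the part in `{x₁ ≤ 0}` of the closed
ball of radius `R₋` centred at `-R₋ cos α e₁`, together with the part in `{x₁ ≥ 0}` of the closed
ball of radius `R₊` centred at `-R₊ cos β e₁`. -/
def candidate (N : ℕ) [NeZero N] (α β Rm Rp : ℝ) : Set (EuclideanSpace ℝ (Fin N)) :=
  (closedBall (EuclideanSpace.single 0 (-(Rm * Real.cos α))) Rm ∩ {x | x 0 ≤ 0}) ∪
    (closedBall (EuclideanSpace.single 0 (-(Rp * Real.cos β))) Rp ∩ {x | 0 ≤ x 0})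

end TwoPhase

end

open Filter Topology Set

namespace TwoPhase

variable {N : ℕ}

/-! The proof is a first variation inside the family of lenses: two balls centred on the axis, cut
by the interface and glued along a common contact sphere of radius `r`. Write `N = m + 1`, and let
`w` be the signed distance from the centre of a ball to the interface, divided by its radius and
counted positive when the centre lies on the side of the cap. Then `w = cos α` on the left and `v =
-cos β` on the right.

With both volumes fixed, each cap near the given one is determined by `r`, and its area has
derivative `-w * (m ω_m r^(m-1))`, where `ω_m` is the volume of the unit ball of `ℝᵐ` and the
bracket is the area of the contact sphere (`exists_cap_family`). When the contact radii agree, the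
topological boundary meets the interface only inside the contact sphere, which is `H^m`-null, so the
`γ` term vanishes (`weightedPerimeter_lens`). Stationarity of `ρ₋ A₋(r) + ρ₊ A₊(r)` then reads `ρ₋ w
+ ρ₊ v = 0`, which is Snell's law.

Two further points are needed. The De Giorgi perimeter of a cap must be computed exactly: Minkowski
content bounds it above (`perimeter_closedBall_le`), and a truncated radial field bounds it below
(`le_perimeter_closedBall`). The type I conditions must also yield a common, strictly positive
contact radius (`contact_radius_eq`, `contact_radius_pos`). -/

/-! ### Divergence theorem and the Minkowski bound for the perimeter -/

theorem continuous_divergence {φ : EuclideanSpace ℝ (Fin N) → EuclideanSpace ℝ (Fin N)}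
    (hφ : ContDiff ℝ 1 φ) : Continuous (divergence φ) := by
  unfold divergence
  have := hφ.continuous_fderiv one_ne_zero
  fun_prop

theorem divergence_eq_zero {φ : EuclideanSpace ℝ (Fin N) → EuclideanSpace ℝ (Fin N)}
    {x : EuclideanSpace ℝ (Fin N)} (hx : x ∉ tsupport φ) : divergence φ x = 0 := by
  have h : fderiv ℝ φ x = 0 := by
    by_contra h
    exact hx (support_fderiv_subset ℝ h)
  simp [divergence, h]

theorem hasCompactSupport_divergence
    {φ : EuclideanSpace ℝ (Fin N) → EuclideanSpace ℝ (Fin N)}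
    (hφ : HasCompactSupport φ) : HasCompactSupport (divergence φ) :=
  HasCompactSupport.intro hφ fun _ hx => divergence_eq_zero hx

theorem integrable_divergence {φ : EuclideanSpace ℝ (Fin N) → EuclideanSpace ℝ (Fin N)}
    (hφ : ContDiff ℝ 1 φ) (hc : HasCompactSupport φ) : Integrable (divergence φ) :=
  (continuous_divergence hφ).integrable_of_hasCompactSupport (hasCompactSupport_divergence hc)

/-- The divergence theorem for a Lipschitz weight. -/
theorem integral_lipschitz_mul_divergence {η : EuclideanSpace ℝ (Fin N) → ℝ} {C : NNReal}
    (hη : LipschitzWith C η) {φ : EuclideanSpace ℝ (Fin N) → EuclideanSpace ℝ (Fin N)}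
    (hφ : ContDiff ℝ 1 φ) (hc : HasCompactSupport φ) :
    ∫ x, η x * divergence φ x = -∫ x, fderiv ℝ η x (φ x) := by
  have hdiff : ∀ᵐ x : EuclideanSpace ℝ (Fin N), DifferentiableAt ℝ η x := hη.ae_differentiableAt
  have hφd : Differentiable ℝ φ := hφ.differentiable one_ne_zero
  have hcomp : ∀ i : Fin N, ContDiff ℝ 1 (fun x => φ x i) := fun i => by fun_prop
  have hcs : ∀ i : Fin N, HasCompactSupport (fun x => φ x i) := fun i =>
    hc.comp_left (g := fun y : EuclideanSpace ℝ (Fin N) => y i) rfl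
  have hcf : Continuous (fderiv ℝ φ) := hφ.continuous_fderiv one_ne_zero
  have hfd : ∀ (i : Fin N) x v, fderiv ℝ (fun x => φ x i) x v = (fderiv ℝ φ x v) i := by
    intro i x v
    have := ((EuclideanSpace.proj (𝕜 := ℝ) i).hasFDerivAt.comp x (hφd x).hasFDerivAt).fderiv
    exact congrArg (fun L => L v) this
  have key : ∀ i : Fin N, ∫ x, η x * (fderiv ℝ φ x (EuclideanSpace.single i 1)) i
      = -∫ x, lineDeriv ℝ η x (EuclideanSpace.single i 1) * φ x i := by
    intro i
    obtain ⟨D, hD⟩ := (hcomp i).lipschitzWith_of_hasCompactSupport (hcs i) one_ne_zero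
    rw [hη.integral_lineDeriv_mul_eq hD (hcs i), ← integral_neg]
    refine integral_congr_ae (Eventually.of_forall fun x => ?_)
    have : lineDeriv ℝ (fun x => φ x i) x (-EuclideanSpace.single i 1)
        = -(fderiv ℝ φ x (EuclideanSpace.single i 1)) i := by
      rw [((hcomp i).differentiable one_ne_zero x).lineDeriv_eq_fderiv, map_neg, hfd]
    simp only [this]
    ring
  have hI : ∀ i : Fin N, Integrable
      (fun x => η x * (fderiv ℝ φ x (EuclideanSpace.single i 1)) i) := by
    intro i
    refine Continuous.integrable_of_hasCompactSupport
      (hη.continuous.mul (by fun_prop)) (HasCompactSupport.mul_left ?_)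
    refine HasCompactSupport.intro hc fun x hx => ?_
    have h : fderiv ℝ φ x = 0 := by
      by_contra h
      exact hx (support_fderiv_subset ℝ h)
    simp [h]
  have hI' : ∀ i : Fin N, Integrable
      (fun x => lineDeriv ℝ η x (EuclideanSpace.single i 1) * φ x i) := by
    intro i
    have h1 : Integrable (fun x => φ x i) :=
      (hcomp i).continuous.integrable_of_hasCompactSupport (hcs i)
    refine h1.bdd_mul (c := C * ‖(EuclideanSpace.single i 1 : EuclideanSpace ℝ (Fin N))‖)
      (measurable_lineDeriv hη.continuous).aestronglyMeasurable
      (Eventually.of_forall fun x => norm_lineDeriv_le_of_lipschitz ℝ hη)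
  calc ∫ x, η x * divergence φ x
      = ∑ i, ∫ x, η x * (fderiv ℝ φ x (EuclideanSpace.single i 1)) i := by
        simp only [divergence, Finset.mul_sum]
        exact integral_finsetSum _ fun i _ => hI i
    _ = -∑ i, ∫ x, lineDeriv ℝ η x (EuclideanSpace.single i 1) * φ x i := by
        simp only [key, Finset.sum_neg_distrib]
    _ = -∫ x, fderiv ℝ η x (φ x) := by
        rw [← integral_finsetSum _ fun i _ => hI' i]
        congr 1
        refine integral_congr_ae (hdiff.mono fun x hx => ?_)
        have hs : φ x = ∑ i, φ x i • (EuclideanSpace.single i (1 : ℝ)) := by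
          ext j
          simp [Finset.sum_apply, Pi.single_apply]
        simp only [hx.lineDeriv_eq_fderiv]
        conv_rhs => rw [hs]
        simp [mul_comm]

/-- The relative perimeter of a closed set is bounded by its lower outer Minkowski content. -/
theorem perimeter_le_of_thickening {E U : Set (EuclideanSpace ℝ (Fin N))} (hE : IsClosed E)
    (hU : MeasurableSet U) {m : ℝ → ℝ} {A : ℝ}
    (hm : ∀ᶠ ε in 𝓝[>] (0 : ℝ),
      volume ((thickening ε E \ E) ∩ U) ≤ ENNReal.ofReal (ε * m ε))
    (hA : Tendsto m (𝓝[>] 0) (𝓝 A)) :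
    perimeter E U ≤ ENNReal.ofReal A := by
  refine iSup_le fun φ => iSup_le fun hφ => iSup_le fun hc => iSup_le fun hs =>
    iSup_le fun h1 => ENNReal.ofReal_le_ofReal_iff'.2 ?_
  by_cases hint : ∫ x in E, divergence φ x ≤ 0
  · exact Or.inr hint
  left
  push Not at hint
  set δ : ℕ → ℝ := fun n => 1 / ((n : ℝ) + 1) with hδ
  have hδ0 : ∀ n, 0 < δ n := fun n => Nat.one_div_pos_of_nat
  have hδlim : Tendsto δ atTop (𝓝 0) := tendsto_one_div_add_atTop_nhds_zero_nat
  have hδlim' : Tendsto δ atTop (𝓝[>] 0) :=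
    tendsto_nhdsWithin_iff.2 ⟨hδlim, Eventually.of_forall hδ0⟩
  -- The weight is 1 on `E`, 0 off the `δ n`-thickening and `(δ n)⁻¹`-Lipschitz, so its gradient
  -- costs at most `(δ n)⁻¹` times the volume of the layer between them.
  set η : ℕ → EuclideanSpace ℝ (Fin N) → ℝ := fun n x => (thickenedIndicator (hδ0 n) E x : ℝ)
  have hηlip : ∀ n, LipschitzWith ((δ n).toNNReal)⁻¹ (η n) := fun n => by
    have h := lipschitzWith_thickenedIndicator (hδ0 n) E
    exact fun x y => h x y
  have hη1 : ∀ n x, η n x ≤ 1 := fun n x => by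
    exact_mod_cast thickenedIndicator_le_one (hδ0 n) E x
  have hη0 : ∀ n x, 0 ≤ η n x := fun n x => NNReal.coe_nonneg _
  have hlim : Tendsto (fun n => ∫ x, η n x * divergence φ x) atTop
      (𝓝 (∫ x in E, divergence φ x)) := by
    rw [← integral_indicator hE.measurableSet]
    refine tendsto_integral_of_dominated_convergence (fun x => ‖divergence φ x‖)
      (fun n => ((hηlip n).continuous.mul (continuous_divergence hφ)).aestronglyMeasurable)
      (integrable_divergence hφ hc).norm
      (fun n => Eventually.of_forall fun x => ?_) (Eventually.of_forall fun x => ?_)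
    · rw [norm_mul, Real.norm_of_nonneg (hη0 n x)]
      exact mul_le_of_le_one_left (norm_nonneg _) (hη1 n x)
    · have h2 := tendsto_pi_nhds.1 (thickenedIndicator_tendsto_indicator_closure hδ0 hδlim E) x
      rw [hE.closure_eq] at h2
      have h3 := ((NNReal.continuous_coe.tendsto _).comp h2).mul_const (divergence φ x)
      have h4 : E.indicator (divergence φ) x
          = ((E.indicator (fun _ => (1 : NNReal)) x : NNReal) : ℝ) * divergence φ x := by
        by_cases hx : x ∈ E <;> simp [hx]
      rw [h4]
      exact h3
  refine le_of_tendsto_of_tendsto hlim (hA.comp hδlim') ?_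
  filter_upwards [hδlim'.eventually hm, hlim.eventually_const_lt hint] with n hn hpos
  set D := (thickening (δ n) E \ E) ∩ U
  have hD : MeasurableSet D :=
    (isOpen_thickening.measurableSet.diff hE.measurableSet).inter hU
  have hDfin : volume D ≠ ∞ := ne_top_of_le_ne_top ENNReal.ofReal_ne_top hn
  have hbound : ∀ x, -fderiv ℝ (η n) x (φ x) ≤ D.indicator (fun _ => (δ n)⁻¹) x := by
    intro x
    by_cases hx : x ∈ D
    · rw [indicator_of_mem hx]
      have h4 : ‖fderiv ℝ (η n) x‖ ≤ (δ n)⁻¹ := by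
        have := norm_fderiv_le_of_lipschitz ℝ (x₀ := x) (hηlip n)
        simpa [Real.coe_toNNReal _ (hδ0 n).le] using this
      calc -fderiv ℝ (η n) x (φ x) ≤ ‖fderiv ℝ (η n) x (φ x)‖ := by
            rw [Real.norm_eq_abs]; exact neg_le_abs _
        _ ≤ ‖fderiv ℝ (η n) x‖ * ‖φ x‖ := ContinuousLinearMap.le_opNorm _ _
        _ ≤ (δ n)⁻¹ * 1 := mul_le_mul h4 (h1 x) (norm_nonneg _) (inv_pos.2 (hδ0 n)).le
        _ = _ := mul_one _
    · rw [indicator_of_notMem hx]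
      by_cases hxU : x ∈ U
      -- Outside the layer the weight attains its global maximum or minimum, so its derivative
      -- vanishes even at points of the frontier; no null set has to be discarded.
      · have hz : fderiv ℝ (η n) x = 0 := by
          by_cases hxE : x ∈ E
          · refine IsLocalMax.fderiv_eq_zero (Eventually.of_forall fun y => ?_)
            have : η n x = 1 := by
              simp only [η, thickenedIndicator_one (hδ0 n) E hxE, NNReal.coe_one]
            rw [this]
            exact hη1 n y
          · have hxT : x ∉ thickening (δ n) E := fun h => hx ⟨⟨h, hxE⟩, hxU⟩
            refine IsLocalMin.fderiv_eq_zero (Eventually.of_forall fun y => ?_)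
            have : η n x = 0 := by
              simp only [η, thickenedIndicator_zero (hδ0 n) E hxT, NNReal.coe_zero]
            rw [this]
            exact hη0 n y
        simp [hz]
      · have : φ x = 0 := by
          by_contra h
          exact hxU (hs (subset_tsupport _ h))
        simp [this]
  have hle : -∫ x, fderiv ℝ (η n) x (φ x) ≤ volume.real D * (δ n)⁻¹ := by
    rw [← integral_neg]
    have h5 : volume.real D * (δ n)⁻¹ = ∫ x, D.indicator (fun _ => (δ n)⁻¹) x := by
      rw [integral_indicator hD, setIntegral_const, smul_eq_mul]
    rw [h5]
    -- If the integrand is not integrable, its Bochner integral is 0 and the bound is trivial.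
    by_cases hi : Integrable (fun x => -fderiv ℝ (η n) x (φ x))
    · exact integral_mono hi ((integrable_indicator_iff hD).2
        (integrableOn_const hDfin)) hbound
    · rw [integral_undef hi]
      exact integral_nonneg fun x => indicator_nonneg (fun _ _ => (inv_pos.2 (hδ0 n)).le) x
  have h6 := integral_lipschitz_mul_divergence (hηlip n) hφ hc
  rw [h6] at hpos ⊢
  -- `ENNReal.ofReal` truncates negative values of `m`; positivity of the integral forces `D` to
  -- have positive volume, which excludes that case.
  have h7 : 0 < volume.real D := by
    by_contra h
    have : volume.real D = 0 := le_antisymm (not_lt.1 h) measureReal_nonneg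
    rw [this, zero_mul] at hle
    exact absurd hle (not_le.2 hpos)
  have h8 : volume.real D ≤ δ n * m (δ n) := by
    rcases le_total 0 (δ n * m (δ n)) with h | h
    · exact ENNReal.toReal_le_of_le_ofReal h hn
    · rw [ENNReal.ofReal_of_nonpos h, nonpos_iff_eq_zero] at hn
      simp [Measure.real, hn] at h7
  refine hle.trans ?_
  rw [← div_eq_mul_inv, div_le_iff₀' (hδ0 n)]
  exact h8

/-! ### Slicing balls by hyperplanes orthogonal to the axis -/

/-- The volume of the unit ball of `ℝᵐ`. -/
noncomputable def unitBallVolume (m : ℕ) : ℝ := √Real.pi ^ m / Real.Gamma (m / 2 + 1)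

theorem unitBallVolume_pos (m : ℕ) : 0 < unitBallVolume m :=
  div_pos (pow_pos (Real.sqrt_pos.2 Real.pi_pos) _) (Real.Gamma_pos_of_pos (by positivity))

/-- The `m`-dimensional volume of the slice at signed distance `t` from the centre of the ball of
radius `R` of `ℝᵐ⁺¹`. -/
noncomputable def sliceVolume (m : ℕ) (R t : ℝ) : ℝ := unitBallVolume m * √(R ^ 2 - t ^ 2) ^ m

theorem sliceVolume_nonneg (m : ℕ) (R t : ℝ) : 0 ≤ sliceVolume m R t :=
  mul_nonneg (unitBallVolume_pos m).le (pow_nonneg (Real.sqrt_nonneg _) _)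

@[fun_prop]
theorem continuous_sliceVolume (m : ℕ) (R : ℝ) : Continuous (sliceVolume m R) := by
  unfold sliceVolume; fun_prop

theorem sliceVolume_neg (m : ℕ) (R t : ℝ) : sliceVolume m R (-t) = sliceVolume m R t := by
  simp [sliceVolume]

/-- The condition `m ≠ 0` matters because `0 ^ 0 = 1`: for `m = 0` the formula would not vanish
outside the ball. -/
theorem sliceVolume_of_le {m : ℕ} (hm : m ≠ 0) {R t : ℝ} (hR : 0 ≤ R) (h : R ≤ |t|) :
    sliceVolume m R t = 0 := by
  have : R ^ 2 - t ^ 2 ≤ 0 := by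
    have := pow_le_pow_left₀ hR h 2
    rw [sq_abs] at this
    linarith
  simp [sliceVolume, Real.sqrt_eq_zero_of_nonpos this, hm]

theorem hasCompactSupport_sliceVolume {m : ℕ} (hm : m ≠ 0) {R : ℝ} (hR : 0 ≤ R) (a : ℝ) :
    HasCompactSupport fun s => sliceVolume m R (s - a) := by
  refine HasCompactSupport.intro (isCompact_closedBall a R) fun s hs => ?_
  refine sliceVolume_of_le hm hR ?_
  rw [mem_closedBall, Real.dist_eq, not_le] at hs
  exact hs.le

theorem sliceVolume_le {m : ℕ} {R : ℝ} (hR : 0 ≤ R) (t : ℝ) :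
    sliceVolume m R t ≤ unitBallVolume m * R ^ m := by
  refine mul_le_mul_of_nonneg_left (pow_le_pow_left₀ (Real.sqrt_nonneg _) ?_ _)
    (unitBallVolume_pos m).le
  exact Real.sqrt_le_iff.2 ⟨hR, by nlinarith [sq_nonneg t]⟩

theorem volume_setOf_sum_sq_le {m : ℕ} (hm : m ≠ 0) (R t : ℝ) :
    volume {y : Fin m → ℝ | t ^ 2 + ∑ i, y i ^ 2 ≤ R ^ 2} = ENNReal.ofReal (sliceVolume m R t) := by
  have : Nonempty (Fin m) := ⟨⟨0, Nat.pos_of_ne_zero hm⟩⟩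
  have hpre : {y : Fin m → ℝ | t ^ 2 + ∑ i, y i ^ 2 ≤ R ^ 2}
      = {y : Fin m → ℝ | ∑ i, y i ^ 2 ≤ R ^ 2 - t ^ 2} := by
    ext y; simp only [mem_ofPred_eq]; constructor <;> intro h <;> linarith
  rw [hpre]
  have hmeas : MeasurableSet {y : Fin m → ℝ | ∑ i, y i ^ 2 ≤ R ^ 2 - t ^ 2} :=
    (isClosed_le (by fun_prop) continuous_const).measurableSet
  rw [← (EuclideanSpace.volume_preserving_symm_measurableEquiv_toLp (Fin m)).measure_preimage
    hmeas.nullMeasurableSet]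
  rcases lt_or_ge (R ^ 2 - t ^ 2) 0 with h | h
  · have h1 : sliceVolume m R t = 0 := by
      simp [sliceVolume, Real.sqrt_eq_zero_of_nonpos h.le, hm]
    rw [h1, ENNReal.ofReal_zero]
    convert measure_empty (μ := (volume : Measure (EuclideanSpace ℝ (Fin m))))
    ext y
    simp only [mem_preimage, mem_ofPred_eq, mem_empty_iff_false, iff_false, not_le]
    exact h.trans_le (Finset.sum_nonneg fun i _ => sq_nonneg _)
  · have h1 : (MeasurableEquiv.toLp 2 (Fin m → ℝ)).symm ⁻¹'
        {y : Fin m → ℝ | ∑ i, y i ^ 2 ≤ R ^ 2 - t ^ 2}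
        = closedBall (0 : EuclideanSpace ℝ (Fin m)) (√(R ^ 2 - t ^ 2)) := by
      ext y
      rw [mem_closedBall_zero_iff, EuclideanSpace.norm_eq, Real.sqrt_le_sqrt_iff h]
      simp
    rw [h1, EuclideanSpace.volume_closedBall, ← ENNReal.ofReal_pow (Real.sqrt_nonneg _),
      ← ENNReal.ofReal_mul (by positivity), Fintype.card_fin, mul_comm]
    rfl

theorem dist_single_sq {m : ℕ} (c : ℝ) (x : EuclideanSpace ℝ (Fin (m + 1))) :
    dist x (EuclideanSpace.single 0 c) ^ 2 = (x 0 - c) ^ 2 + ∑ i : Fin m, x i.succ ^ 2 := by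
  rw [EuclideanSpace.dist_eq, Real.sq_sqrt (Finset.sum_nonneg fun _ _ => sq_nonneg _),
    Fin.sum_univ_succ]
  simp [Real.dist_eq]

theorem mem_closedBall_single {m : ℕ} (c : ℝ) {R : ℝ} (hR : 0 ≤ R)
    (x : EuclideanSpace ℝ (Fin (m + 1))) :
    x ∈ closedBall (EuclideanSpace.single 0 c) R
      ↔ (x 0 - c) ^ 2 + ∑ i : Fin m, x i.succ ^ 2 ≤ R ^ 2 := by
  rw [mem_closedBall, ← dist_single_sq, sq_le_sq₀ dist_nonneg hR]

/-- Fubini after splitting off the first coordinate: each slice is an `m`-ball of squared radius `R²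
- (s - c)²`, or empty. -/
theorem volume_closedBall_inter_preimage {m : ℕ} (hm : m ≠ 0) (c : ℝ) {R : ℝ} (hR : 0 ≤ R)
    {A : Set ℝ} (hA : MeasurableSet A) :
    volume (closedBall (EuclideanSpace.single 0 c : EuclideanSpace ℝ (Fin (m + 1))) R
      ∩ {x | x 0 ∈ A}) = ∫⁻ s in A, ENNReal.ofReal (sliceVolume m R (s - c)) := by
  set D : Set (ℝ × (Fin m → ℝ)) := {p | (p.1 - c) ^ 2 + ∑ i, p.2 i ^ 2 ≤ R ^ 2} ∩ {p | p.1 ∈ A}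
  have hD : MeasurableSet D :=
    (isClosed_le (by fun_prop) continuous_const).measurableSet.inter (measurable_fst hA)
  have h1 := (volume_preserving_piFinSuccAbove (fun _ : Fin (m + 1) => ℝ) 0).comp
    (EuclideanSpace.volume_preserving_symm_measurableEquiv_toLp (Fin (m + 1)))
  have h2 := h1.measure_preimage hD.nullMeasurableSet
  have h3 : (closedBall (EuclideanSpace.single 0 c : EuclideanSpace ℝ (Fin (m + 1))) R
      ∩ {x | x 0 ∈ A}) = ((MeasurableEquiv.piFinSuccAbove (fun _ : Fin (m + 1) => ℝ) 0) ∘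
        (MeasurableEquiv.toLp 2 (Fin (m + 1) → ℝ)).symm) ⁻¹' D := by
    ext x
    simp only [mem_inter_iff, mem_closedBall_single c hR]
    rfl
  rw [h3, h2, Measure.volume_eq_prod, Measure.prod_apply hD, ← lintegral_indicator hA]
  refine lintegral_congr fun s => ?_
  by_cases hs : s ∈ A
  · rw [indicator_of_mem hs, ← volume_setOf_sum_sq_le hm]
    congr 1
    ext y
    simp [D, hs]
  · rw [indicator_of_notMem hs]
    convert measure_empty (μ := (volume : Measure (Fin m → ℝ)))
    ext y
    simp [D, hs]

/-- The slicing formula for balls centred on the first coordinate axis. The sign `σ = ±1` treats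
both orientations of the axis. -/
theorem map_restrict_closedBall {m : ℕ} (hm : m ≠ 0) {σ : ℝ} (hσ : σ = 1 ∨ σ = -1) (a : ℝ) {R : ℝ}
    (hR : 0 ≤ R) :
    (volume.restrict (closedBall
      (EuclideanSpace.single 0 (σ * a) : EuclideanSpace ℝ (Fin (m + 1))) R)).map
        (fun x => σ * x 0)
      = volume.withDensity fun s => ENNReal.ofReal (sliceVolume m R (s - a)) := by
  have hmeas : Measurable fun x : EuclideanSpace ℝ (Fin (m + 1)) => σ * x 0 := by fun_prop
  ext A hA
  rw [Measure.map_apply hmeas hA, withDensity_apply _ hA, Measure.restrict_apply (hmeas hA),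
    inter_comm]
  rcases hσ with rfl | rfl
  · rw [← volume_closedBall_inter_preimage hm a hR hA]
    simp [preimage]
  · have hA' : MeasurableSet (-A) := hA.neg
    have := volume_closedBall_inter_preimage hm (-1 * a) hR hA'
    have h2 : ∫⁻ s in -A, ENNReal.ofReal (sliceVolume m R (s - -1 * a))
        = ∫⁻ s in A, ENNReal.ofReal (sliceVolume m R (s - a)) := by
      rw [← (Measure.measurePreserving_neg (volume : Measure ℝ)).setLIntegral_comp_preimage hA
        (by fun_prop)]
      refine lintegral_congr fun s => ?_
      rw [← sliceVolume_neg]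
      ring_nf
    rw [← h2, ← this]
    congr 2
    ext x
    simp

theorem integral_closedBall_comp {m : ℕ} (hm : m ≠ 0) {σ : ℝ} (hσ : σ = 1 ∨ σ = -1) (a : ℝ) {R : ℝ}
    (hR : 0 ≤ R) {f : ℝ → ℝ} (hf : Measurable f) :
    ∫ x in closedBall (EuclideanSpace.single 0 (σ * a) : EuclideanSpace ℝ (Fin (m + 1))) R,
      f (σ * x 0) = ∫ s, sliceVolume m R (s - a) * f s := by
  have hmeas : Measurable fun x : EuclideanSpace ℝ (Fin (m + 1)) => σ * x 0 := by fun_prop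
  rw [← integral_map (φ := fun x : EuclideanSpace ℝ (Fin (m + 1)) => σ * x 0) (f := f)
    hmeas.aemeasurable hf.aestronglyMeasurable, map_restrict_closedBall hm hσ a hR,
    integral_withDensity_eq_integral_toReal_smul (by fun_prop) (by simp)]
  simp [ENNReal.toReal_ofReal (sliceVolume_nonneg _ _ _)]

theorem volume_closedBall_inter {m : ℕ} (hm : m ≠ 0) {σ : ℝ} (hσ : σ = 1 ∨ σ = -1) (a : ℝ) {R : ℝ}
    (hR : 0 ≤ R) {A : Set ℝ} (hA : MeasurableSet A) :
    volume (closedBall (EuclideanSpace.single 0 (σ * a) : EuclideanSpace ℝ (Fin (m + 1))) R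
      ∩ {x | σ * x 0 ∈ A}) = ∫⁻ s in A, ENNReal.ofReal (sliceVolume m R (s - a)) := by
  have hmeas : Measurable fun x : EuclideanSpace ℝ (Fin (m + 1)) => σ * x 0 := by fun_prop
  rw [← withDensity_apply _ hA, ← map_restrict_closedBall hm hσ a hR, Measure.map_apply hmeas hA,
    Measure.restrict_apply (hmeas hA), inter_comm]
  rfl

theorem volume_slab_le {m : ℕ} (hm : m ≠ 0) {σ : ℝ} (hσ : σ = 1 ∨ σ = -1) (a : ℝ) {R : ℝ}
    (hR : 0 ≤ R) {ε : ℝ} (hε : 0 ≤ ε) :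
    volume (closedBall (EuclideanSpace.single 0 (σ * a) : EuclideanSpace ℝ (Fin (m + 1))) R
      ∩ {x | σ * x 0 ∈ Icc 0 ε}) ≤ ENNReal.ofReal (ε * (unitBallVolume m * R ^ m)) := by
  rw [volume_closedBall_inter hm hσ a hR measurableSet_Icc]
  calc ∫⁻ s in Icc 0 ε, ENNReal.ofReal (sliceVolume m R (s - a))
      ≤ ∫⁻ s in Icc 0 ε, ENNReal.ofReal (unitBallVolume m * R ^ m) :=
        lintegral_mono fun s => ENNReal.ofReal_le_ofReal (sliceVolume_le hR _)
    _ = _ := by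
        rw [setLIntegral_const, Real.volume_Icc, ← ENNReal.ofReal_mul' (by linarith), sub_zero,
          mul_comm]

/-! ### Volume of a cap -/

/-- The integral of `(1 - t²)^(m/2)` over `[-1, w]`. -/
noncomputable def chordIntegral (m : ℕ) (w : ℝ) : ℝ := ∫ t in (-1)..w, √(1 - t ^ 2) ^ m

theorem hasStrictDerivAt_chordIntegral (m : ℕ) (w : ℝ) :
    HasStrictDerivAt (chordIntegral m) (√(1 - w ^ 2) ^ m) w := by
  have hc : Continuous fun t : ℝ => √(1 - t ^ 2) ^ m := by fun_prop
  exact intervalIntegral.integral_hasStrictDerivAt_right (hc.intervalIntegrable _ _)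
    (hc.stronglyMeasurableAtFilter _ _) hc.continuousAt

theorem chordIntegral_neg_one (m : ℕ) : chordIntegral m (-1) = 0 := by simp [chordIntegral]

theorem chordIntegral_pos (m : ℕ) {w : ℝ} (hw : -1 < w) (hw1 : w ≤ 1) : 0 < chordIntegral m w := by
  refine intervalIntegral.intervalIntegral_pos_of_pos_on
    (Continuous.intervalIntegrable (by fun_prop) _ _) (fun t ht => ?_) hw
  refine pow_pos (Real.sqrt_pos.2 ?_) _
  nlinarith [ht.1, ht.2]

/-- The volume of the part of a ball of radius `R` cut off by a hyperplane at signed distance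
`R * w` from the centre. -/
noncomputable def capVolume (m : ℕ) (R w : ℝ) : ℝ :=
  unitBallVolume m * R ^ (m + 1) * chordIntegral m w

theorem integral_sliceVolume_Iio {m : ℕ} (hm : m ≠ 0) {R : ℝ} (hR : 0 < R) {a : ℝ} (ha : |a| < R) :
    ∫ s in Iio 0, sliceVolume m R (s - a) = capVolume m R (-a / R) := by
  have ha' := abs_lt.1 ha
  have h1 : ∫ s in Iio 0, sliceVolume m R (s - a) = ∫ s in (a - R)..0, sliceVolume m R (s - a) := by
    rw [intervalIntegral.integral_of_le (by linarith), integral_Ioc_eq_integral_Ioo]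
    refine setIntegral_eq_of_subset_of_forall_sdiff_eq_zero measurableSet_Iio
      Ioo_subset_Iio_self fun s hs => ?_
    have : s ≤ a - R := by
      by_contra h
      exact hs.2 ⟨not_le.1 h, hs.1⟩
    exact sliceVolume_of_le hm hR.le (by rw [abs_of_nonpos] <;> linarith)
  rw [h1]
  have h2 : ∀ s, sliceVolume m R (s - a)
      = unitBallVolume m * R ^ m * (fun t => √(1 - t ^ 2) ^ m) (s / R - a / R) := by
    intro s
    have : R ^ 2 - (s - a) ^ 2 = R ^ 2 * (1 - (s / R - a / R) ^ 2) := by field_simp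
    simp only [sliceVolume]
    rw [this, Real.sqrt_mul (sq_nonneg R), Real.sqrt_sq hR.le, mul_pow, mul_assoc]
  simp only [h2]
  rw [intervalIntegral.integral_const_mul,
    intervalIntegral.integral_comp_div_sub (fun t => √(1 - t ^ 2) ^ m) hR.ne']
  have h3 : (a - R) / R - a / R = -1 := by field_simp; ring
  have h4 : 0 / R - a / R = -a / R := by ring
  rw [h3, h4, capVolume, chordIntegral, smul_eq_mul]
  ring

theorem lintegral_sliceVolume_Iio {m : ℕ} (hm : m ≠ 0) {R : ℝ} (hR : 0 < R) {a : ℝ}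
    (ha : |a| < R) :
    ∫⁻ s in Iio 0, ENNReal.ofReal (sliceVolume m R (s - a))
      = ENNReal.ofReal (capVolume m R (-a / R)) := by
  rw [← integral_sliceVolume_Iio hm hR ha, ofReal_integral_eq_lintegral_ofReal]
  · exact Integrable.integrableOn (Continuous.integrable_of_hasCompactSupport (by fun_prop)
      (hasCompactSupport_sliceVolume hm hR.le a))
  · exact Eventually.of_forall fun s => sliceVolume_nonneg _ _ _

theorem volume_closedBall_inter_half {m : ℕ} (hm : m ≠ 0) {σ : ℝ} (hσ : σ = 1 ∨ σ = -1) {a R : ℝ}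
    (hR : 0 < R) (ha : |a| < R) :
    volume (closedBall (EuclideanSpace.single 0 (σ * a) : EuclideanSpace ℝ (Fin (m + 1))) R
      ∩ {x | σ * x 0 < 0}) = ENNReal.ofReal (capVolume m R (-a / R)) :=
  (volume_closedBall_inter hm hσ a hR.le measurableSet_Iio).trans
    (lintegral_sliceVolume_Iio hm hR ha)

/-! ### Upper bound for the perimeter of a cap -/

/-- Test fields supported in `U`, and hence their divergences, do not see the set outside `U`. -/
theorem perimeter_congr {N : ℕ} {S T U : Set (EuclideanSpace ℝ (Fin N))} (hU : MeasurableSet U)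
    (h : S ∩ U = T ∩ U) : perimeter S U = perimeter T U := by
  have key : ∀ (E : Set (EuclideanSpace ℝ (Fin N))) φ, tsupport φ ⊆ U →
      ∫ x in E, divergence φ x = ∫ x in E ∩ U, divergence φ x := by
    intro E φ hs
    rw [← setIntegral_indicator hU]
    congr 1
    ext x
    by_cases hx : x ∈ U
    · rw [indicator_of_mem hx]
    · rw [indicator_of_notMem hx, divergence_eq_zero fun h => hx (hs h)]
  unfold perimeter
  refine iSup_congr fun φ => iSup_congr fun hφ => iSup_congr fun hc => iSup_congr fun hs => ?_
  rw [key S φ hs, key T φ hs, h]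

/-- The area of the spherical cap cut off from the sphere of radius `R` by a hyperplane at signed
distance `R * w` from the centre. -/
noncomputable def capArea (m : ℕ) (R w : ℝ) : ℝ :=
  unitBallVolume m * R ^ m * ((m + 1) * chordIntegral m w - w * √(1 - w ^ 2) ^ m)

/-- With the centre fixed, enlarging the radius moves the cap at unit normal speed, so the volume
grows at the rate of the area. Here `a` is constant and the relative height `-a / R` varies with
`R`. -/
theorem hasDerivAt_capVolume (m : ℕ) {R : ℝ} (hR : 0 < R) (a : ℝ) :
    HasDerivAt (fun R => capVolume m R (-a / R)) (capArea m R (-a / R)) R := by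
  have h1 : HasDerivAt (fun R => -a / R) (-(-a) / R ^ 2) R := by
    refine HasDerivAt.congr_deriv ((hasDerivAt_const R (-a)).div (hasDerivAt_id R) hR.ne') ?_
    simp
  have h2 := ((hasStrictDerivAt_chordIntegral m (-a / R)).hasDerivAt.comp R h1)
  have h3 := ((hasDerivAt_pow (m + 1) R).const_mul (unitBallVolume m)).mul h2
  refine h3.congr_deriv ?_
  simp only [capArea, Function.comp_apply, Nat.add_sub_cancel]
  push_cast
  field_simp
  ring

theorem thickening_closedBall_subset {E : Type*} [PseudoMetricSpace E] (c : E) (R ε : ℝ) :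
    thickening ε (closedBall c R) ⊆ closedBall c (R + ε) := by
  intro x hx
  obtain ⟨y, hy, hxy⟩ := mem_thickening_iff.1 hx
  rw [mem_closedBall] at hy ⊢
  linarith [dist_triangle x y c]

/-- A thickened ball lies in a concentric ball, so the Minkowski quotient is bounded by the
difference quotient of the cap volume in the radius. -/
theorem perimeter_closedBall_le {m : ℕ} (hm : m ≠ 0) {σ : ℝ} (hσ : σ = 1 ∨ σ = -1) {a R : ℝ}
    (hR : 0 < R) (ha : |a| < R) :
    perimeter (closedBall (EuclideanSpace.single 0 (σ * a) : EuclideanSpace ℝ (Fin (m + 1))) R)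
      {x | σ * x 0 < 0} ≤ ENNReal.ofReal (capArea m R (-a / R)) := by
  set c : EuclideanSpace ℝ (Fin (m + 1)) := EuclideanSpace.single 0 (σ * a) with hc
  set H : Set (EuclideanSpace ℝ (Fin (m + 1))) := {x | σ * x 0 < 0} with hH
  have hHm : MeasurableSet H := (isOpen_lt (by fun_prop) continuous_const).measurableSet
  set f : ℝ → ℝ := fun R => capVolume m R (-a / R) with hf
  refine perimeter_le_of_thickening (m := fun ε => ε⁻¹ • (f (R + ε) - f R)) isClosed_closedBall hHm
    ?_ ((hasDerivAt_iff_tendsto_slope_zero.1 (hasDerivAt_capVolume m hR a)).mono_left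
      (nhdsWithin_mono _ fun x hx => ne_of_gt hx))
  filter_upwards [self_mem_nhdsWithin] with ε hε
  have hε : 0 < ε := hε
  have h1 : (thickening ε (closedBall c R) \ closedBall c R) ∩ H
      ⊆ (closedBall c (R + ε) ∩ H) \ (closedBall c R ∩ H) := fun x hx =>
    ⟨⟨thickening_closedBall_subset _ _ _ hx.1.1, hx.2⟩, fun h => hx.1.2 h.1⟩
  refine (measure_mono h1).trans ?_
  rw [measure_sdiff (inter_subset_inter_left _ (closedBall_subset_closedBall (by linarith)))
    (isClosed_closedBall.measurableSet.inter hHm).nullMeasurableSet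
    (ne_top_of_le_ne_top measure_closedBall_lt_top.ne (measure_mono inter_subset_left)),
    volume_closedBall_inter_half hm hσ hR ha,
    volume_closedBall_inter_half hm hσ (by linarith) (by linarith),
    smul_eq_mul, mul_inv_cancel_left₀ hε.ne', ENNReal.ofReal_sub]
  have h0 := chordIntegral_pos m (w := -a / R)
    (by rw [lt_div_iff₀ hR]; linarith [(abs_lt.1 ha).2])
    (by rw [div_le_one hR]; linarith [(abs_lt.1 ha).1])
  have := unitBallVolume_pos m
  change 0 ≤ unitBallVolume m * R ^ (m + 1) * chordIntegral m (-a / R)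
  positivity

theorem volume_shell_le {m : ℕ} (c : EuclideanSpace ℝ (Fin (m + 1))) {R ε : ℝ} (hR : 0 ≤ R)
    (hε : 0 < ε) :
    volume (closedBall c (R + ε) \ closedBall c R) ≤ ENNReal.ofReal (ε * (ε⁻¹ •
      (volume.real (ball (0 : EuclideanSpace ℝ (Fin (m + 1))) 1) * (R + ε) ^ (m + 1)
        - volume.real (ball (0 : EuclideanSpace ℝ (Fin (m + 1))) 1) * R ^ (m + 1)))) := by
  rw [smul_eq_mul, mul_inv_cancel_left₀ hε.ne', measure_sdiff
    (closedBall_subset_closedBall (by linarith)) isClosed_closedBall.measurableSet.nullMeasurableSet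
    measure_closedBall_lt_top.ne, Measure.addHaar_closedBall _ _ (by linarith),
    Measure.addHaar_closedBall _ _ hR, ENNReal.ofReal_sub _ (by positivity),
    ENNReal.ofReal_mul (by positivity), ENNReal.ofReal_mul (by positivity), Measure.real,
    ENNReal.ofReal_toReal measure_ball_lt_top.ne]
  simp only [finrank_euclideanSpace, Fintype.card_fin]
  rw [mul_comm, mul_comm (ENNReal.ofReal (R ^ (m + 1)))]

/-! ### Lenses and their finite perimeter -/

/-- Two balls centred on the axis, cut along the interface and glued. -/
def lens (m : ℕ) (a R b Q : ℝ) : Set (EuclideanSpace ℝ (Fin (m + 1))) :=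
  (closedBall (EuclideanSpace.single 0 (1 * a)) R ∩ {x | x 0 ≤ 0}) ∪
    (closedBall (EuclideanSpace.single 0 (-1 * b)) Q ∩ {x | 0 ≤ x 0})

theorem isClosed_lens (m : ℕ) (a R b Q : ℝ) : IsClosed (lens m a R b Q) :=
  (isClosed_closedBall.inter (isClosed_le (by fun_prop) continuous_const)).union
    (isClosed_closedBall.inter (isClosed_le continuous_const (by fun_prop)))

/-- A point near one half of the lens either stays on that side, and then lies in a shell of the
ball, or crosses the interface by at most `ε`, and then lies in a thin slab. The slabs are needed
because the two balls may cut different discs from the interface. -/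
theorem thickening_lens_diff_subset {m : ℕ} {a R b Q ε : ℝ} :
    thickening ε (lens m a R b Q) \ lens m a R b Q ⊆
      ((closedBall (EuclideanSpace.single 0 (1 * a)) (R + ε)
          \ closedBall (EuclideanSpace.single 0 (1 * a)) R) ∪
        (closedBall (EuclideanSpace.single 0 (1 * a)) (R + ε) ∩ {x | 1 * x 0 ∈ Icc 0 ε})) ∪
      ((closedBall (EuclideanSpace.single 0 (-1 * b)) (Q + ε)
          \ closedBall (EuclideanSpace.single 0 (-1 * b)) Q) ∪
        (closedBall (EuclideanSpace.single 0 (-1 * b)) (Q + ε) ∩ {x | -1 * x 0 ∈ Icc 0 ε})) := by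
  rintro x ⟨hx, hxT⟩
  obtain ⟨y, hy, hxy⟩ := mem_thickening_iff.1 hx
  have h0 : |x 0 - y 0| < ε := by
    have := PiLp.norm_apply_le (x - y) 0
    rw [← dist_eq_norm] at this
    exact lt_of_le_of_lt (by simpa using this) hxy
  have h0' := abs_lt.1 h0
  rcases hy with ⟨hy, hy0⟩ | ⟨hy, hy0⟩
  · left
    have hb := thickening_closedBall_subset _ _ _ (mem_thickening_iff.2 ⟨y, hy, hxy⟩)
    have hy0 : y 0 ≤ 0 := hy0
    rcases le_total (x 0) 0 with h | h
    · exact Or.inl ⟨hb, fun h' => hxT (Or.inl ⟨h', h⟩)⟩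
    · exact Or.inr ⟨hb, by rw [mem_ofPred_eq]; constructor <;> linarith⟩
  · right
    have hb := thickening_closedBall_subset _ _ _ (mem_thickening_iff.2 ⟨y, hy, hxy⟩)
    have hy0 : 0 ≤ y 0 := hy0
    rcases le_total (x 0) 0 with h | h
    · exact Or.inr ⟨hb, by rw [mem_ofPred_eq]; constructor <;> linarith⟩
    · exact Or.inl ⟨hb, fun h' => hxT (Or.inr ⟨h', h⟩)⟩

theorem hasFinitePerimeter_lens {m : ℕ} (hm : m ≠ 0) (a b : ℝ) {R Q : ℝ} (hR : 0 < R)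
    (hQ : 0 < Q) : HasFinitePerimeter (lens m a R b Q) := by
  refine ⟨(isClosed_lens m a R b Q).measurableSet.nullMeasurableSet, ?_⟩
  set κ := volume.real (ball (0 : EuclideanSpace ℝ (Fin (m + 1))) 1)
  -- Shell volume divided by `ε`, plus a bound for the slab volume divided by `ε`. Only the
  -- existence of a finite limit matters.
  set p : ℝ → ℝ → ℝ := fun R ε => ε⁻¹ • (κ * (R + ε) ^ (m + 1) - κ * R ^ (m + 1))
    + unitBallVolume m * (R + ε) ^ m with hp
  have hplim : ∀ R, ∃ L, Tendsto (p R) (𝓝[>] 0) (𝓝 L) := by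
    intro R
    have h1 := (hasDerivAt_iff_tendsto_slope_zero.1
      ((hasDerivAt_pow (m + 1) R).const_mul κ)).mono_left
        (nhdsWithin_mono (0 : ℝ) (s := Ioi 0) fun x (hx : 0 < x) => ne_of_gt hx)
    have h2 : Tendsto (fun ε => unitBallVolume m * (R + ε) ^ m) (𝓝[>] 0)
        (𝓝 (unitBallVolume m * (R + 0) ^ m)) :=
      (Continuous.tendsto (by fun_prop) 0).mono_left nhdsWithin_le_nhds
    exact ⟨_, h1.add h2⟩
  obtain ⟨L, hL⟩ := hplim R
  obtain ⟨M, hM⟩ := hplim Q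
  refine (perimeter_le_of_thickening (isClosed_lens m a R b Q) MeasurableSet.univ ?_
    (hL.add hM)).trans_lt ENNReal.ofReal_lt_top
  filter_upwards [self_mem_nhdsWithin] with ε hε
  have hε : 0 < ε := hε
  have hpart : ∀ {σ : ℝ} (_ : σ = 1 ∨ σ = -1) (a : ℝ) {R : ℝ} (_ : 0 < R),
      volume ((closedBall (EuclideanSpace.single 0 (σ * a) : EuclideanSpace ℝ (Fin (m + 1))) (R + ε)
          \ closedBall (EuclideanSpace.single 0 (σ * a)) R) ∪
        (closedBall (EuclideanSpace.single 0 (σ * a)) (R + ε) ∩ {x | σ * x 0 ∈ Icc 0 ε}))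
        ≤ ENNReal.ofReal (ε * p R ε) := by
    intro σ hσ a R hR
    refine (measure_union_le _ _).trans ((add_le_add (volume_shell_le _ hR.le hε)
      (volume_slab_le hm hσ a (by linarith) hε.le)).trans ?_)
    rw [← ENNReal.ofReal_add, ← mul_add]
    · rw [smul_eq_mul, mul_inv_cancel_left₀ hε.ne', sub_nonneg]
      gcongr
      linarith
    · have := unitBallVolume_pos m
      positivity
  have hp0 : ∀ R, 0 < R → 0 ≤ ε * p R ε := by
    intro R hR
    have := unitBallVolume_pos m
    refine mul_nonneg hε.le (add_nonneg (mul_nonneg (by positivity) ?_) (by positivity))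
    rw [sub_nonneg]
    gcongr
    linarith
  rw [inter_univ]
  refine (measure_mono thickening_lens_diff_subset).trans ((measure_union_le _ _).trans
    ((add_le_add (hpart (Or.inl rfl) a hR) (hpart (Or.inr rfl) b hQ)).trans ?_))
  rw [← ENNReal.ofReal_add (hp0 R hR) (hp0 Q hQ), ← mul_add]

theorem lens_inter_leftHalf (m : ℕ) (a R b Q : ℝ) :
    lens m a R b Q ∩ {x | 1 * x 0 < 0}
      = closedBall (EuclideanSpace.single 0 (1 * a)) R ∩ {x | 1 * x 0 < 0} := by
  ext x
  simp only [lens, one_mul, mem_inter_iff, mem_union, mem_ofPred_eq]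
  constructor
  · rintro ⟨⟨h, -⟩ | ⟨-, h⟩, h'⟩
    · exact ⟨h, h'⟩
    · exact absurd h (not_le.2 h')
  · rintro ⟨h, h'⟩
    exact ⟨Or.inl ⟨h, h'.le⟩, h'⟩

theorem lens_inter_rightHalf (m : ℕ) (a R b Q : ℝ) :
    lens m a R b Q ∩ {x | -1 * x 0 < 0}
      = closedBall (EuclideanSpace.single 0 (-1 * b)) Q ∩ {x | -1 * x 0 < 0} := by
  ext x
  simp only [lens, neg_mul, one_mul, neg_lt_zero, mem_inter_iff, mem_union, mem_ofPred_eq]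
  constructor
  · rintro ⟨⟨-, h⟩ | ⟨h, -⟩, h'⟩
    · exact absurd h (not_le.2 h')
    · exact ⟨h, h'⟩
  · rintro ⟨h, h'⟩
    exact ⟨Or.inr ⟨h, h'.le⟩, h'⟩

theorem leftHalf_eq (m : ℕ) : leftHalf (m + 1) = {x | 1 * x 0 < 0} := by
  ext x; simp [leftHalf]

theorem rightHalf_eq (m : ℕ) : rightHalf (m + 1) = {x | -1 * x 0 < 0} := by
  ext x; simp [rightHalf]

/-! ### Lower bound for the perimeter of a cap -/

theorem hasCompactSupport_deriv_smoothTransition :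
    HasCompactSupport (deriv Real.smoothTransition) := by
  refine HasCompactSupport.intro (isCompact_Icc (a := (0 : ℝ)) (b := 1)) fun y hy => ?_
  rw [mem_Icc, not_and_or, not_le, not_le] at hy
  rcases hy with hy | hy
  · have : Real.smoothTransition =ᶠ[𝓝 y] fun _ => 0 := by
      filter_upwards [Iio_mem_nhds hy] with z hz
      exact Real.smoothTransition.zero_of_nonpos (le_of_lt hz)
    rw [this.deriv_eq, deriv_const]
  · have : Real.smoothTransition =ᶠ[𝓝 y] fun _ => 1 := by
      filter_upwards [Ioi_mem_nhds hy] with z hz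
      exact Real.smoothTransition.one_of_one_le (le_of_lt hz)
    rw [this.deriv_eq, deriv_const]

theorem continuous_deriv_smoothTransition : Continuous (deriv Real.smoothTransition) :=
  (Real.smoothTransition.contDiff (n := 1)).continuous_deriv le_rfl

theorem integral_deriv_smoothTransition : ∫ y, deriv Real.smoothTransition y = 1 := by
  have h := integral_of_hasDerivAt_of_tendsto (f := Real.smoothTransition)
    (f' := deriv Real.smoothTransition) (m := 0) (n := 1)
    (fun x => ((Real.smoothTransition.contDiff (n := 1)).differentiable one_ne_zero x).hasDerivAt)
    (continuous_deriv_smoothTransition.integrable_of_hasCompactSupport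
      hasCompactSupport_deriv_smoothTransition)
    (tendsto_const_nhds.congr' ?_) (tendsto_const_nhds.congr' ?_)
  · rw [h, sub_zero]
  · filter_upwards [eventually_le_atBot 0] with z hz
    exact (Real.smoothTransition.zero_of_nonpos hz).symm
  · filter_upwards [eventually_ge_atTop 1] with z hz
    exact (Real.smoothTransition.one_of_one_le hz).symm

/-- A smooth approximation, from below, of the indicator function of the negative half-line. -/
noncomputable def stepDown (n : ℕ) (s : ℝ) : ℝ := Real.smoothTransition (-(n + 1) * s - 1)

theorem contDiff_stepDown (n : ℕ) : ContDiff ℝ 1 (stepDown n) :=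
  (Real.smoothTransition.contDiff (n := 1)).comp (by fun_prop)

theorem stepDown_nonneg (n : ℕ) (s : ℝ) : 0 ≤ stepDown n s := Real.smoothTransition.nonneg _

theorem stepDown_le_one (n : ℕ) (s : ℝ) : stepDown n s ≤ 1 := Real.smoothTransition.le_one _

theorem stepDown_eq_zero {n : ℕ} {s : ℝ} (h : -(1 / ((n : ℝ) + 1)) ≤ s) : stepDown n s = 0 := by
  refine Real.smoothTransition.zero_of_nonpos ?_
  have h1 : (0 : ℝ) < n + 1 := by positivity
  have h2 := mul_le_mul_of_nonneg_left h h1.le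
  have h3 : ((n : ℝ) + 1) * -(1 / ((n : ℝ) + 1)) = -1 := by field_simp
  linarith

theorem tendsto_stepDown (s : ℝ) :
    Tendsto (fun n => stepDown n s) atTop (𝓝 ((Iio (0 : ℝ)).indicator 1 s)) := by
  rcases lt_or_ge s 0 with hs | hs
  · rw [indicator_of_mem (by exact hs)]
    refine tendsto_const_nhds.congr' ?_
    have h1 : Tendsto (fun n : ℕ => ((n : ℝ) + 1) * -s) atTop atTop :=
      (tendsto_atTop_add_const_right _ _ tendsto_natCast_atTop_atTop).atTop_mul_const
        (neg_pos.2 hs)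
    filter_upwards [h1.eventually_ge_atTop 2] with n hn
    exact (Real.smoothTransition.one_of_one_le (by linarith)).symm
  · rw [indicator_of_notMem (by simpa using hs)]
    refine tendsto_const_nhds.congr fun n => (stepDown_eq_zero ?_).symm
    have : (0 : ℝ) ≤ 1 / ((n : ℝ) + 1) := by positivity
    linarith

theorem deriv_stepDown (n : ℕ) (s : ℝ) :
    deriv (stepDown n) s = -(n + 1) * deriv Real.smoothTransition (-(n + 1) * s - 1) := by
  have h1 : HasDerivAt (fun s : ℝ => -((n : ℝ) + 1) * s - 1) (-(n + 1)) s := by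
    simpa using ((hasDerivAt_id s).const_mul (-((n : ℝ) + 1))).sub_const 1
  have h2 := ((Real.smoothTransition.contDiff (n := 1)).differentiable one_ne_zero
    (-((n : ℝ) + 1) * s - 1)).hasDerivAt
  rw [mul_comm]
  exact (h2.comp s h1).deriv

/-- The derivatives of the steps tend to minus the Dirac mass at 0: rescaling by `y = -(n + 1) s`
turns them into a fixed profile of integral 1. -/
theorem tendsto_integral_deriv_stepDown_mul {G : ℝ → ℝ} (hG : Continuous G)
    {C : ℝ} (hC : ∀ s, |G s| ≤ C) :
    Tendsto (fun n => ∫ s, deriv (stepDown n) s * G s) atTop (𝓝 (-G 0)) := by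
  have h1 : ∀ n : ℕ, ∫ s, deriv (stepDown n) s * G s
      = -∫ y, deriv Real.smoothTransition (y - 1) * G (-(1 / ((n : ℝ) + 1)) * y) := by
    intro n
    have hn : (0 : ℝ) < n + 1 := by positivity
    have h := Measure.integral_comp_mul_left
      (fun y => deriv Real.smoothTransition (y - 1) * G (-(1 / ((n : ℝ) + 1)) * y))
      (-((n : ℝ) + 1))
    have h2 : ∀ s, -(1 / ((n : ℝ) + 1)) * (-((n : ℝ) + 1) * s) = s := by intro s; field_simp
    simp only [h2] at h
    simp only [deriv_stepDown, mul_assoc]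
    rw [integral_const_mul, h, inv_neg, abs_neg, abs_of_pos (inv_pos.2 hn), smul_eq_mul, neg_mul,
      mul_inv_cancel_left₀ hn.ne']
  simp only [h1]
  have hint : Integrable fun y => deriv Real.smoothTransition (y - 1) :=
    (continuous_deriv_smoothTransition.integrable_of_hasCompactSupport
      hasCompactSupport_deriv_smoothTransition).comp_sub_right 1
  have h3 : -G 0 = -∫ y, deriv Real.smoothTransition (y - 1) * G 0 := by
    rw [integral_mul_const, integral_sub_right_eq_self (fun y => deriv Real.smoothTransition y) 1,
      integral_deriv_smoothTransition, one_mul]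
  rw [h3]
  have hcd := continuous_deriv_smoothTransition
  refine (tendsto_integral_of_dominated_convergence
    (fun y => ‖deriv Real.smoothTransition (y - 1)‖ * C)
    (fun n => Continuous.aestronglyMeasurable (by fun_prop)) (hint.norm.mul_const C)
    (fun n => Eventually.of_forall fun y => ?_) (Eventually.of_forall fun y => ?_)).neg
  · rw [norm_mul]
    exact mul_le_mul_of_nonneg_left (hC _) (norm_nonneg _)
  · refine Tendsto.const_mul _ ?_
    have h4 : Tendsto (fun n : ℕ => -(1 / ((n : ℝ) + 1)) * y) atTop (𝓝 0) := by
      simpa using (tendsto_one_div_add_atTop_nhds_zero_nat (𝕜 := ℝ)).neg.mul_const y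
    exact (hG.tendsto 0).comp h4

/-- The integrand is the sliced divergence of the radial field cut off by `stepDown n`. In the limit
it gives `m + 1` times the volume minus the flux `-a * sliceVolume m R a` through the flat face; by
the divergence theorem this is the flux `R * area` through the cap. -/
theorem tendsto_integral_sliceVolume_stepDown {m : ℕ} (hm : m ≠ 0) {R a : ℝ} (hR : 0 < R)
    (ha : |a| < R) :
    Tendsto (fun n => ∫ s, sliceVolume m R (s - a) *
        ((m + 1) * stepDown n s + deriv (stepDown n) s * (s - a))) atTop
      (𝓝 (R * capArea m R (-a / R))) := by
  have hcs := hasCompactSupport_sliceVolume hm hR.le a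
  have hcont : Continuous fun s => sliceVolume m R (s - a) := by fun_prop
  have hsv : Integrable fun s => sliceVolume m R (s - a) :=
    hcont.integrable_of_hasCompactSupport hcs
  have h1 : Tendsto (fun n => ∫ s, sliceVolume m R (s - a) * stepDown n s) atTop
      (𝓝 (capVolume m R (-a / R))) := by
    rw [← integral_sliceVolume_Iio hm hR ha, ← integral_indicator measurableSet_Iio]
    refine tendsto_integral_of_dominated_convergence (fun s => ‖sliceVolume m R (s - a)‖)
      (fun n => (hcont.mul (contDiff_stepDown n).continuous).aestronglyMeasurable) hsv.norm
      (fun n => Eventually.of_forall fun s => ?_) (Eventually.of_forall fun s => ?_)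
    · rw [norm_mul, Real.norm_of_nonneg (stepDown_nonneg n s)]
      exact mul_le_of_le_one_right (norm_nonneg _) (stepDown_le_one n s)
    · have h := (tendsto_stepDown s).const_mul (sliceVolume m R (s - a))
      have h2 : (Iio (0 : ℝ)).indicator (fun s => sliceVolume m R (s - a)) s
          = sliceVolume m R (s - a) * (Iio (0 : ℝ)).indicator 1 s := by
        by_cases hs : s ∈ Iio (0 : ℝ) <;> simp [indicator, hs]
      rw [h2]
      exact h
  have hG : Continuous fun s => (s - a) * sliceVolume m R (s - a) := by fun_prop
  have hGs : HasCompactSupport fun s => (s - a) * sliceVolume m R (s - a) := hcs.mul_left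
  obtain ⟨C, hC⟩ := hG.bounded_above_of_compact_support hGs
  have h2 := tendsto_integral_deriv_stepDown_mul hG hC
  have h3 := (h1.const_mul ((m : ℝ) + 1)).add h2
  have hlim : ((m : ℝ) + 1) * capVolume m R (-a / R) + -((0 - a) * sliceVolume m R (0 - a))
      = R * capArea m R (-a / R) := by
    have h4 : R ^ 2 - (0 - a) ^ 2 = R ^ 2 * (1 - (-a / R) ^ 2) := by field_simp; ring
    have h5 : -a = R * (-a / R) := by field_simp
    rw [sliceVolume, h4, Real.sqrt_mul (sq_nonneg R), Real.sqrt_sq hR.le, zero_sub]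
    simp only [capVolume, capArea]
    generalize hw : -a / R = w at h5 ⊢
    rw [h5]
    ring
  rw [hlim] at h3
  refine h3.congr fun n => ?_
  have hd : Continuous (deriv (stepDown n)) := (contDiff_stepDown n).continuous_deriv le_rfl
  have hst : Continuous (stepDown n) := (contDiff_stepDown n).continuous
  rw [← integral_const_mul, ← integral_add]
  · congr 1
    ext s
    ring
  · exact ((hcont.mul hst).integrable_of_hasCompactSupport hcs.mul_right).const_mul _
  · exact (hd.mul hG).integrable_of_hasCompactSupport hGs.mul_left

theorem divergence_smul_sub {N : ℕ} {f : EuclideanSpace ℝ (Fin N) → ℝ}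
    {x : EuclideanSpace ℝ (Fin N)} (hf : DifferentiableAt ℝ f x) (c : EuclideanSpace ℝ (Fin N)) :
    divergence (fun x => f x • (x - c)) x = N * f x + fderiv ℝ f x (x - c) := by
  have h1 := hf.hasFDerivAt.smul ((hasFDerivAt_id x).sub_const c)
  have h2 : fderiv ℝ (fun x => f x • (x - c)) x
      = f x • ContinuousLinearMap.id ℝ _ + (fderiv ℝ f x).smulRight (x - c) := h1.fderiv
  have hs : x - c = ∑ i, (x - c) i • (EuclideanSpace.single i (1 : ℝ)) := by
    ext j
    simp [Finset.sum_apply, Pi.single_apply]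
  rw [divergence, h2]
  conv_rhs => rw [hs]
  simp [Finset.sum_add_distrib, mul_comm]

theorem setIntegral_closedBall_eq_ball {N : ℕ} [NeZero N] {c : EuclideanSpace ℝ (Fin N)} {R : ℝ}
    (f : EuclideanSpace ℝ (Fin N) → ℝ) : ∫ x in closedBall c R, f x = ∫ x in ball c R, f x := by
  have : Nonempty (Fin N) := ⟨0⟩
  refine setIntegral_congr_set ?_
  refine (ae_eq_of_subset_of_measure_ge ball_subset_closedBall ?_
    measurableSet_ball.nullMeasurableSet measure_closedBall_lt_top.ne).symm
  exact (Measure.addHaar_closedBall_eq_addHaar_ball _ _ _).le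

/-- The test field is `(x - c) / Q`, an approximate unit normal on the cap, multiplied by `stepDown
n` to keep its support in the open half-space and by a bump equal to 1 on the ball. The bump needs
room to decay, so its outer radius is some `Q > R`, and dividing by `Q` keeps the norm at most 1.
Then `n → ∞`, followed by `Q → R`. -/
theorem le_perimeter_closedBall {m : ℕ} (hm : m ≠ 0) {σ : ℝ} (hσ : σ = 1 ∨ σ = -1) {a R : ℝ}
    (hR : 0 < R) (ha : |a| < R) :
    ENNReal.ofReal (capArea m R (-a / R)) ≤
      perimeter (closedBall (EuclideanSpace.single 0 (σ * a) : EuclideanSpace ℝ (Fin (m + 1))) R)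
        {x | σ * x 0 < 0} := by
  set c : EuclideanSpace ℝ (Fin (m + 1)) := EuclideanSpace.single 0 (σ * a) with hc
  have hσσ : σ * σ = 1 := by rcases hσ with rfl | rfl <;> norm_num
  have hfield : ∀ (n : ℕ) (Q : ℝ), R < Q →
      ENNReal.ofReal (Q⁻¹ * ∫ s, sliceVolume m R (s - a) *
        ((m + 1) * stepDown n s + deriv (stepDown n) s * (s - a)))
      ≤ perimeter (closedBall c R) {x | σ * x 0 < 0} := by
    intro n Q hQ
    have hQ0 : 0 < Q := hR.trans hQ
    let χ : ContDiffBump c := ⟨R, Q, hR, hQ⟩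
    have hst := contDiff_stepDown n
    have hχ : ContDiff ℝ 1 χ := χ.contDiff
    have hx0 : ContDiff ℝ 1 fun x : EuclideanSpace ℝ (Fin (m + 1)) => σ * x 0 := by fun_prop
    have hstx : ContDiff ℝ 1 fun x : EuclideanSpace ℝ (Fin (m + 1)) => stepDown n (σ * x 0) :=
      hst.comp hx0
    set φ : EuclideanSpace ℝ (Fin (m + 1)) → EuclideanSpace ℝ (Fin (m + 1)) := fun x =>
      (Q⁻¹ * (stepDown n (σ * x 0) * χ x)) • (x - c) with hφ
    have h1 : ContDiff ℝ 1 φ := by fun_prop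
    have h2 : HasCompactSupport φ := by
      refine HasCompactSupport.intro (isCompact_closedBall c Q) fun x hx => ?_
      have : χ x = 0 := χ.zero_of_le_dist (by
        rw [mem_closedBall, not_le] at hx
        exact hx.le)
      simp [hφ, this]
    have h3 : tsupport φ ⊆ {x | σ * x 0 < 0} := by
      have hcl : IsClosed {x : EuclideanSpace ℝ (Fin (m + 1)) |
          σ * x 0 ≤ -(1 / ((n : ℝ) + 1))} := isClosed_le (by fun_prop) continuous_const
      have hsub : Function.support φ ⊆ {x : EuclideanSpace ℝ (Fin (m + 1)) |
          σ * x 0 ≤ -(1 / ((n : ℝ) + 1))} := by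
        intro x hx
        by_contra h
        refine hx ?_
        simp only [hφ, stepDown_eq_zero (not_le.1 h).le, zero_mul, mul_zero, zero_smul]
      intro x hx
      have := closure_minimal hsub hcl hx
      rw [mem_ofPred_eq] at this ⊢
      have h0 : 0 < 1 / ((n : ℝ) + 1) := by positivity
      linarith
    have h4 : ∀ x, ‖φ x‖ ≤ 1 := by
      intro x
      by_cases hx : dist x c < Q
      · rw [hφ, norm_smul, Real.norm_of_nonneg (mul_nonneg (inv_pos.2 hQ0).le
          (mul_nonneg (stepDown_nonneg _ _) χ.nonneg)), ← dist_eq_norm, mul_assoc,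
          inv_mul_le_one₀ hQ0]
        calc stepDown n (σ * x 0) * χ x * dist x c ≤ 1 * 1 * dist x c := by
              gcongr
              · exact χ.nonneg
              · exact stepDown_le_one _ _
              · exact χ.le_one
          _ ≤ Q := by linarith
      · have : χ x = 0 := χ.zero_of_le_dist (not_lt.1 hx)
        simp [hφ, this]
    have h5 : ∀ x ∈ ball c R, divergence φ x = Q⁻¹ * ((m + 1) * stepDown n (σ * x 0)
        + deriv (stepDown n) (σ * x 0) * (σ * x 0 - a)) := by
      intro x hx
      have heq : φ =ᶠ[𝓝 x] fun x => (Q⁻¹ * stepDown n (σ * x 0)) • (x - c) := by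
        filter_upwards [isOpen_ball.mem_nhds hx] with y hy
        have : χ y = 1 := χ.one_of_mem_closedBall (ball_subset_closedBall hy)
        simp [hφ, this]
      have hdiff : DifferentiableAt ℝ (fun x : EuclideanSpace ℝ (Fin (m + 1)) =>
          Q⁻¹ * stepDown n (σ * x 0)) x :=
        ((hstx.differentiable one_ne_zero) x).const_mul _
      have hd : divergence φ x
          = divergence (fun x => (Q⁻¹ * stepDown n (σ * x 0)) • (x - c)) x := by
        simp only [divergence, heq.fderiv_eq]
      have hp : HasFDerivAt (fun x : EuclideanSpace ℝ (Fin (m + 1)) => σ * x 0)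
          (σ • (EuclideanSpace.proj (𝕜 := ℝ) (0 : Fin (m + 1)))) x :=
        (EuclideanSpace.proj (𝕜 := ℝ) (0 : Fin (m + 1))).hasFDerivAt.const_mul σ
      have hf := ((hst.differentiable one_ne_zero (σ * x 0)).hasDerivAt.comp_hasFDerivAt x
        hp).const_mul Q⁻¹
      have hf' : fderiv ℝ (fun x : EuclideanSpace ℝ (Fin (m + 1)) =>
          Q⁻¹ * stepDown n (σ * x 0)) x = Q⁻¹ • deriv (stepDown n) (σ * x 0) •
            (σ • (EuclideanSpace.proj (𝕜 := ℝ) (0 : Fin (m + 1)))) := hf.fderiv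
      rw [hd, divergence_smul_sub hdiff, hf']
      have hxc : σ * (x 0 - σ * a) = σ * x 0 - a := by linear_combination (-a) * hσσ
      simp [hc, hxc]
      ring
    have hmeas : Measurable fun s =>
        Q⁻¹ * ((m + 1) * stepDown n s + deriv (stepDown n) s * (s - a)) := by
      have := hst.continuous
      have := hst.continuous_deriv le_rfl
      exact Continuous.measurable (by fun_prop)
    have h6 : ∫ x in closedBall c R, divergence φ x = Q⁻¹ * ∫ s, sliceVolume m R (s - a) *
        ((m + 1) * stepDown n s + deriv (stepDown n) s * (s - a)) := by
      -- The divergence formula is available only on the open ball, where the bump is locally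
      -- constant; the sphere is null.
      rw [setIntegral_closedBall_eq_ball, setIntegral_congr_fun measurableSet_ball h5,
        ← setIntegral_closedBall_eq_ball, integral_closedBall_comp hm hσ a hR.le hmeas,
        ← integral_const_mul]
      congr 1
      ext s
      ring
    rw [← h6]
    exact le_iSup_of_le φ (le_iSup_of_le h1 (le_iSup_of_le h2 (le_iSup_of_le h3
      (le_iSup_of_le h4 le_rfl))))
  have hn : ∀ Q, R < Q → ENNReal.ofReal (Q⁻¹ * (R * capArea m R (-a / R)))
      ≤ perimeter (closedBall c R) {x | σ * x 0 < 0} := fun Q hQ =>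
    le_of_tendsto (ENNReal.tendsto_ofReal
      ((tendsto_integral_sliceVolume_stepDown hm hR ha).const_mul Q⁻¹))
      (Eventually.of_forall fun n => hfield n Q hQ)
  have hlim : Tendsto (fun Q : ℝ => ENNReal.ofReal (Q⁻¹ * (R * capArea m R (-a / R)))) (𝓝[>] R)
      (𝓝 (ENNReal.ofReal (R⁻¹ * (R * capArea m R (-a / R))))) :=
    ENNReal.tendsto_ofReal ((((continuousAt_inv₀ hR.ne').tendsto).mul_const _).mono_left
      nhdsWithin_le_nhds)
  rw [inv_mul_cancel_left₀ hR.ne'] at hlim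
  exact le_of_tendsto hlim (eventually_mem_nhdsWithin.mono fun Q hQ => hn Q hQ)

/-! ### Caps of fixed volume parametrized by the contact radius -/

theorem hasStrictDerivAt_sqrt_one_sub_sq {w : ℝ} (hw : |w| < 1) :
    HasStrictDerivAt (fun w => √(1 - w ^ 2)) (-w / √(1 - w ^ 2)) w := by
  have h0 : 0 < 1 - w ^ 2 := by
    have := (sq_lt_one_iff_abs_lt_one w).2 hw
    linarith
  have h1 : HasStrictDerivAt (fun w : ℝ => 1 - w ^ 2) (-(2 * w)) w := by
    simpa using (hasStrictDerivAt_pow 2 w).const_sub 1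
  refine (h1.sqrt h0.ne').congr_deriv ?_
  have := (Real.sqrt_pos.2 h0).ne'
  field_simp

/-- The normalized area of a cap. -/
noncomputable def capAreaFactor (m : ℕ) (w : ℝ) : ℝ :=
  (m + 1) * chordIntegral m w - w * √(1 - w ^ 2) ^ m

theorem capArea_eq (m : ℕ) (R w : ℝ) :
    capArea m R w = unitBallVolume m * R ^ m * capAreaFactor m w := rfl

theorem continuous_chordIntegral (m : ℕ) : Continuous (chordIntegral m) :=
  continuous_iff_continuousAt.2 fun w => (hasStrictDerivAt_chordIntegral m w).hasDerivAt.continuousAt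

theorem hasStrictDerivAt_capAreaFactor (m : ℕ) {w : ℝ} (hw : |w| < 1) :
    HasStrictDerivAt (capAreaFactor m)
      (m * √(1 - w ^ 2) ^ m + m * w ^ 2 * √(1 - w ^ 2) ^ (m - 1) / √(1 - w ^ 2)) w := by
  have h1 := (hasStrictDerivAt_chordIntegral m w).const_mul ((m : ℝ) + 1)
  have h2 := (hasStrictDerivAt_id w).mul ((hasStrictDerivAt_sqrt_one_sub_sq hw).pow m)
  refine (h1.sub h2).congr_deriv ?_
  simp only [id, Pi.pow_apply]
  ring

theorem capAreaFactor_pos {m : ℕ} (hm : m ≠ 0) {w : ℝ} (hw : |w| < 1) : 0 < capAreaFactor m w := by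
  have hc : ContinuousOn (capAreaFactor m) (Icc (-1) 1) := by
    have := continuous_chordIntegral m
    unfold capAreaFactor
    fun_prop
  have hmono : StrictMonoOn (capAreaFactor m) (Icc (-1) 1) := by
    refine strictMonoOn_of_deriv_pos (convex_Icc _ _) hc fun x hx => ?_
    rw [interior_Icc] at hx
    have hx' : |x| < 1 := abs_lt.2 hx
    rw [(hasStrictDerivAt_capAreaFactor m hx').hasDerivAt.deriv]
    have h0 : 0 < √(1 - x ^ 2) :=
      Real.sqrt_pos.2 (by have := (sq_lt_one_iff_abs_lt_one x).2 hx'; linarith)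
    have : (0 : ℝ) < m := by exact_mod_cast Nat.pos_of_ne_zero hm
    positivity
  have hw' := abs_lt.1 hw
  have h := hmono (by simp) ⟨hw'.1.le, hw'.2.le⟩ hw'.1
  have h0 : capAreaFactor m (-1) = 0 := by
    simp [capAreaFactor, chordIntegral_neg_one, hm]
  rwa [h0] at h

/-- The sign is unclear only for `w < 0`. The expression vanishes at `-1` and its derivative is
`capAreaFactor m`, which is positive. This is what makes the contact radius a valid parameter. -/
theorem capRadius_deriv_factor_pos {m : ℕ} (hm : m ≠ 0) {w : ℝ} (hw : |w| < 1) :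
    0 < √(1 - w ^ 2) ^ (m + 2) + (m + 1) * w * chordIntegral m w := by
  set q : ℝ → ℝ := fun w => √(1 - w ^ 2) ^ (m + 2) + (m + 1) * w * chordIntegral m w with hq
  have hc : ContinuousOn q (Icc (-1) 1) := by
    have := continuous_chordIntegral m
    fun_prop
  have hmono : StrictMonoOn q (Icc (-1) 1) := by
    refine strictMonoOn_of_deriv_pos (convex_Icc _ _) hc fun x hx => ?_
    rw [interior_Icc] at hx
    have hx' : |x| < 1 := abs_lt.2 hx
    have h0 : 0 < √(1 - x ^ 2) :=
      Real.sqrt_pos.2 (by have := (sq_lt_one_iff_abs_lt_one x).2 hx'; linarith)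
    have h1 := (hasStrictDerivAt_sqrt_one_sub_sq hx').hasDerivAt.pow (m + 2)
    have h2 := ((hasDerivAt_id x).const_mul ((m : ℝ) + 1)).mul
      (hasStrictDerivAt_chordIntegral m x).hasDerivAt
    have h3 : HasDerivAt q (capAreaFactor m x) x := by
      refine (h1.add h2).congr_deriv ?_
      simp only [capAreaFactor, id]
      push_cast
      field_simp
      ring
    rw [h3.deriv]
    exact capAreaFactor_pos hm hx'
  have hw' := abs_lt.1 hw
  have h := hmono (by simp) ⟨hw'.1.le, hw'.2.le⟩ hw'.1
  have h0 : q (-1) = 0 := by simp [hq, chordIntegral_neg_one]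
  rwa [h0] at h

/-- The caps of prescribed volume near a given one, parametrized by the radius `r` of their
boundary, and the derivative of their area with respect to `r`. -/
theorem exists_cap_family {m : ℕ} (hm : m ≠ 0) {R₀ w₀ : ℝ} (hR : 0 < R₀) (hw : |w₀| < 1) :
    ∃ R w : ℝ → ℝ,
      (∀ᶠ r in 𝓝 (R₀ * √(1 - w₀ ^ 2)), 0 < R r ∧ |w r| < 1 ∧ R r * √(1 - w r ^ 2) = r ∧
        capVolume m (R r) (w r) = capVolume m R₀ w₀) ∧
      capArea m (R (R₀ * √(1 - w₀ ^ 2))) (w (R₀ * √(1 - w₀ ^ 2))) = capArea m R₀ w₀ ∧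
      HasDerivAt (fun r => capArea m (R r) (w r))
        (-w₀ * (unitBallVolume m * m * (R₀ * √(1 - w₀ ^ 2)) ^ (m - 1)))
        (R₀ * √(1 - w₀ ^ 2)) := by
  have hw' := abs_lt.1 hw
  have hp : 0 < √(1 - w₀ ^ 2) :=
    Real.sqrt_pos.2 (by have := (sq_lt_one_iff_abs_lt_one w₀).2 hw; linarith)
  have hg : 0 < chordIntegral m w₀ := chordIntegral_pos m hw'.1 hw'.2.le
  have hq := capRadius_deriv_factor_pos hm hw
  -- The radius that keeps `R ^ (m + 1) * chordIntegral m w` constant, so that the volume is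
  -- preserved.
  set ρ : ℝ → ℝ := fun w =>
    R₀ * (chordIntegral m w₀ / chordIntegral m w) ^ (((m + 1 : ℕ) : ℝ)⁻¹) with hρ
  have hρ0 : ρ w₀ = R₀ := by simp [hρ, div_self hg.ne']
  have hρd : HasStrictDerivAt ρ
      (-(R₀ * √(1 - w₀ ^ 2) ^ m / ((m + 1) * chordIntegral m w₀))) w₀ := by
    have h1 := (hasStrictDerivAt_const w₀ (chordIntegral m w₀)).div
      (hasStrictDerivAt_chordIntegral m w₀) hg.ne'
    have h2 := (Real.hasStrictDerivAt_rpow_const_of_ne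
      (x := chordIntegral m w₀ / chordIntegral m w₀) (by rw [div_self hg.ne']; exact one_ne_zero)
      (((m + 1 : ℕ) : ℝ)⁻¹))
    refine ((h2.comp w₀ h1).const_mul R₀).congr_deriv ?_
    rw [div_self hg.ne', Real.one_rpow]
    push_cast
    field_simp
    ring
  set rad : ℝ → ℝ := fun w => ρ w * √(1 - w ^ 2) with hrad
  -- The derivative of the contact radius in `w` at fixed volume. Being nonzero, it lets the inverse
  -- function theorem express `w` through `r`.
  set d := -(R₀ / ((m + 1) * chordIntegral m w₀ * √(1 - w₀ ^ 2)) *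
    (√(1 - w₀ ^ 2) ^ (m + 2) + (m + 1) * w₀ * chordIntegral m w₀)) with hd
  have hd0 : d ≠ 0 := by
    refine neg_ne_zero.2 (ne_of_gt ?_)
    positivity
  have hradd : HasStrictDerivAt rad d w₀ := by
    refine (hρd.mul (hasStrictDerivAt_sqrt_one_sub_sq hw)).congr_deriv ?_
    rw [hρ0, hd]
    field_simp
    ring
  have hrad0 : rad w₀ = R₀ * √(1 - w₀ ^ 2) := by simp only [hrad, hρ0]
  have hE := hradd.hasStrictFDerivAt_equiv hd0
  set ψ := hradd.localInverse rad d w₀ hd0 with hψ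
  have hψ0 : ψ (rad w₀) = w₀ := hE.localInverse_apply_image
  have hψd : HasStrictDerivAt ψ d⁻¹ (rad w₀) := hradd.to_localInverse hd0
  have hψr : ∀ᶠ r in 𝓝 (rad w₀), rad (ψ r) = r := hE.eventually_right_inverse
  have hψc : Tendsto ψ (𝓝 (rad w₀)) (𝓝 w₀) := by
    have := hψd.hasDerivAt.continuousAt.tendsto
    rwa [hψ0] at this
  -- The factor `d` is left explicit, to cancel against the derivative `d⁻¹` of the local inverse.
  have hA : HasDerivAt (fun w => capArea m (ρ w) w)
      (-w₀ * (unitBallVolume m * m * (R₀ * √(1 - w₀ ^ 2)) ^ (m - 1)) * d) w₀ := by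
    have h1 := ((hρd.hasDerivAt.pow m).const_mul (unitBallVolume m)).mul
      (hasStrictDerivAt_capAreaFactor m hw).hasDerivAt
    refine h1.congr_deriv ?_
    simp only [Pi.pow_apply, hρ0]
    obtain ⟨k, rfl⟩ := Nat.exists_eq_succ_of_ne_zero hm
    simp only [Nat.succ_eq_add_one, Nat.add_sub_cancel, hd, capAreaFactor, mul_pow]
    set p := √(1 - w₀ ^ 2)
    set g := chordIntegral (k + 1) w₀
    push_cast
    field_simp
    ring
  rw [← hrad0]
  refine ⟨fun r => ρ (ψ r), ψ, ?_, ?_, ?_⟩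
  · filter_upwards [hψr, hψc.eventually (Ioo_mem_nhds hw'.1 hw'.2)] with r hr hr1
    have hgr : 0 < chordIntegral m (ψ r) := chordIntegral_pos m hr1.1 hr1.2.le
    have hdiv : 0 < chordIntegral m w₀ / chordIntegral m (ψ r) := div_pos hg hgr
    refine ⟨mul_pos hR (Real.rpow_pos_of_pos hdiv _), abs_lt.2 hr1, hr, ?_⟩
    simp only [capVolume, hρ]
    rw [mul_pow, Real.rpow_inv_natCast_pow hdiv.le (Nat.succ_ne_zero m)]
    field_simp
  · simp only [hψ0, hρ0]
  · rw [hrad0] at hψd hψ0 ⊢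
    rw [← hψ0] at hA
    refine (hA.comp _ hψd.hasDerivAt).congr_deriv ?_
    rw [hψ0, mul_inv_cancel_right₀ hd0]

/-! ### The interface term vanishes -/

theorem isometry_toLp_cons_zero (m : ℕ) : Isometry fun y : EuclideanSpace ℝ (Fin m) =>
    (WithLp.toLp 2 (Fin.cons 0 y : Fin (m + 1) → ℝ) : EuclideanSpace ℝ (Fin (m + 1))) := by
  refine Isometry.of_dist_eq fun x y => ?_
  rw [EuclideanSpace.dist_eq, EuclideanSpace.dist_eq, Fin.sum_univ_succ]
  simp

/-- The contact sphere lies in an isometric image of a sphere of `ℝᵐ`, which is Lebesgue-null. -/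
theorem euclideanHausdorffMeasure_interface_sphere {m : ℕ} (hm : m ≠ 0) {r : ℝ} (hr : 0 ≤ r) :
    (μHE[m] : Measure (EuclideanSpace ℝ (Fin (m + 1))))
      {x | x 0 = 0 ∧ ∑ i : Fin m, x i.succ ^ 2 = r ^ 2} = 0 := by
  have : Nonempty (Fin m) := ⟨⟨0, Nat.pos_of_ne_zero hm⟩⟩
  have hsub : {x : EuclideanSpace ℝ (Fin (m + 1)) | x 0 = 0 ∧ ∑ i : Fin m, x i.succ ^ 2 = r ^ 2}
      ⊆ (fun y : EuclideanSpace ℝ (Fin m) =>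
        (WithLp.toLp 2 (Fin.cons 0 y : Fin (m + 1) → ℝ) : EuclideanSpace ℝ (Fin (m + 1)))) ''
          sphere 0 r := by
    rintro x ⟨h0, h1⟩
    refine ⟨WithLp.toLp 2 fun i => x i.succ, ?_, ?_⟩
    · rw [mem_sphere_zero_iff_norm, EuclideanSpace.norm_eq]
      simp [h1, Real.sqrt_sq hr]
    · ext i
      refine Fin.cases ?_ (fun i => ?_) i <;> simp [h0]
  refine measure_mono_null hsub ?_
  rw [(isometry_toLp_cons_zero m).euclideanHausdorffMeasure_image,
    EuclideanSpace.euclideanHausdorffMeasure_eq_volume]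
  exact Measure.addHaar_sphere _ _ _

/-- The hypotheses say that both balls cut the same disc from the interface. A point inside this
disc lies in both open balls, whose intersection is an open subset of the lens, so it is not a
frontier point. -/
theorem bdryInterface_lens_subset {m : ℕ} {a R b Q r : ℝ} (hR : 0 ≤ R) (hQ : 0 ≤ Q)
    (h1 : a ^ 2 + r ^ 2 = R ^ 2) (h2 : b ^ 2 + r ^ 2 = Q ^ 2) :
    bdryInterface (lens m a R b Q) ⊆ {x | x 0 = 0 ∧ ∑ i : Fin m, x i.succ ^ 2 = r ^ 2} := by
  rintro x ⟨hx, hx0⟩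
  have hx0 : x 0 = 0 := hx0
  refine ⟨hx0, le_antisymm ?_ ?_⟩
  · rcases (isClosed_lens m a R b Q).frontier_subset hx with ⟨h, -⟩ | ⟨h, -⟩
    · rw [mem_closedBall_single _ hR, hx0] at h
      linarith
    · rw [mem_closedBall_single _ hQ, hx0] at h
      linarith
  · by_contra hlt
    rw [not_le] at hlt
    refine hx.2 (mem_interior.2 ⟨ball (EuclideanSpace.single 0 (1 * a)) R ∩
      ball (EuclideanSpace.single 0 (-1 * b)) Q, ?_, isOpen_ball.inter isOpen_ball, ?_, ?_⟩)
    · intro y hy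
      rcases le_total (y 0) 0 with h | h
      · exact Or.inl ⟨ball_subset_closedBall hy.1, h⟩
      · exact Or.inr ⟨ball_subset_closedBall hy.2, h⟩
    · rw [mem_ball, ← sq_lt_sq₀ dist_nonneg hR, dist_single_sq, hx0]
      linarith
    · rw [mem_ball, ← sq_lt_sq₀ dist_nonneg hQ, dist_single_sq, hx0]
      linarith

/-! ### Weighted perimeter and admissibility of lenses -/

theorem perimeter_closedBall_inter_half {m : ℕ} (hm : m ≠ 0) {σ : ℝ} (hσ : σ = 1 ∨ σ = -1)
    {R w : ℝ} (hR : 0 < R) (hw : |w| < 1) :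
    perimeter (closedBall (EuclideanSpace.single 0 (σ * -(R * w)) :
      EuclideanSpace ℝ (Fin (m + 1))) R) {x | σ * x 0 < 0} = ENNReal.ofReal (capArea m R w) := by
  have ha : |-(R * w)| < R := by
    rw [abs_neg, abs_mul, abs_of_pos hR]
    exact mul_lt_of_lt_one_right hR hw
  have hq : -(-(R * w)) / R = w := by field_simp
  have h1 := perimeter_closedBall_le hm hσ hR ha
  have h2 := le_perimeter_closedBall hm hσ hR ha
  rw [hq] at h1 h2
  exact le_antisymm h1 h2

theorem volume_closedBall_inter_half' {m : ℕ} (hm : m ≠ 0) {σ : ℝ} (hσ : σ = 1 ∨ σ = -1)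
    {R w : ℝ} (hR : 0 < R) (hw : |w| < 1) :
    volume (closedBall (EuclideanSpace.single 0 (σ * -(R * w)) :
      EuclideanSpace ℝ (Fin (m + 1))) R ∩ {x | σ * x 0 < 0})
      = ENNReal.ofReal (capVolume m R w) := by
  have ha : |-(R * w)| < R := by
    rw [abs_neg, abs_mul, abs_of_pos hR]
    exact mul_lt_of_lt_one_right hR hw
  have hq : -(-(R * w)) / R = w := by field_simp
  have h1 := volume_closedBall_inter_half hm hσ hR ha
  rwa [hq] at h1

theorem capArea_nonneg {m : ℕ} (hm : m ≠ 0) {R w : ℝ} (hR : 0 < R) (hw : |w| < 1) :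
    0 ≤ capArea m R w := by
  have h1 := capAreaFactor_pos hm hw
  have h2 := unitBallVolume_pos m
  rw [capArea_eq]
  positivity

theorem weightedPerimeter_lens {m : ℕ} (hm : m ≠ 0) {ρm ρp γ : ℝ} (hρm : 0 < ρm) (hρp : 0 < ρp)
    {R w Q v : ℝ} (hR : 0 < R) (hw : |w| < 1) (hQ : 0 < Q) (hv : |v| < 1)
    (hrad : R * √(1 - w ^ 2) = Q * √(1 - v ^ 2)) :
    weightedPerimeter ρm ρp γ (lens m (-(R * w)) R (-(Q * v)) Q)
      = ENNReal.ofReal (ρm * capArea m R w + ρp * capArea m Q v) := by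
  have hsq : ∀ {R w : ℝ}, |w| < 1 → (-(R * w)) ^ 2 + (R * √(1 - w ^ 2)) ^ 2 = R ^ 2 := by
    intro R w hw
    rw [mul_pow, Real.sq_sqrt (by have := (sq_lt_one_iff_abs_lt_one w).2 hw; linarith)]
    ring
  have h0 : μHE[m] (bdryInterface (lens m (-(R * w)) R (-(Q * v)) Q)) = 0 :=
    measure_mono_null
      (bdryInterface_lens_subset hR.le hQ.le (hsq hw) (by rw [hrad]; exact hsq hv))
      (euclideanHausdorffMeasure_interface_sphere hm (by positivity))
  have hml : MeasurableSet {x : EuclideanSpace ℝ (Fin (m + 1)) | 1 * x 0 < 0} :=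
    (isOpen_lt (by fun_prop) continuous_const).measurableSet
  have hmr : MeasurableSet {x : EuclideanSpace ℝ (Fin (m + 1)) | -1 * x 0 < 0} :=
    (isOpen_lt (by fun_prop) continuous_const).measurableSet
  rw [weightedPerimeter, Nat.add_sub_cancel, h0, mul_zero, add_zero, leftHalf_eq, rightHalf_eq,
    perimeter_congr hml (lens_inter_leftHalf _ _ _ _ _),
    perimeter_congr hmr (lens_inter_rightHalf _ _ _ _ _),
    perimeter_closedBall_inter_half hm (Or.inl rfl) hR hw,
    perimeter_closedBall_inter_half hm (Or.inr rfl) hQ hv, ← ENNReal.ofReal_mul hρm.le,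
    ← ENNReal.ofReal_mul hρp.le, ← ENNReal.ofReal_add
      (mul_nonneg hρm.le (capArea_nonneg hm hR hw)) (mul_nonneg hρp.le (capArea_nonneg hm hQ hv))]

theorem isAdmissible_lens_iff {m : ℕ} (hm : m ≠ 0) {ρm ρp Vm Vp : ℝ}
    {R w Q v : ℝ} (hR : 0 < R) (hw : |w| < 1) (hQ : 0 < Q) (hv : |v| < 1) :
    IsAdmissible ρm ρp Vm Vp (lens m (-(R * w)) R (-(Q * v)) Q) ↔
      ENNReal.ofReal ρm * ENNReal.ofReal (capVolume m R w) = ENNReal.ofReal Vm ∧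
      ENNReal.ofReal ρp * ENNReal.ofReal (capVolume m Q v) = ENNReal.ofReal Vp := by
  rw [IsAdmissible, leftHalf_eq, rightHalf_eq, lens_inter_leftHalf, lens_inter_rightHalf,
    volume_closedBall_inter_half' hm (Or.inl rfl) hR hw,
    volume_closedBall_inter_half' hm (Or.inr rfl) hQ hv]
  exact and_iff_right (hasFinitePerimeter_lens hm _ _ hR hQ)

/-- The right half is viewed with the axis reversed, so its relative height is `-cos β`; this sign
puts the two cosines on opposite sides of Snell's law. -/
theorem candidate_eq_lens (m : ℕ) (α β Rm Rp : ℝ) :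
    candidate (m + 1) α β Rm Rp
      = lens m (-(Rm * Real.cos α)) Rm (-(Rp * -Real.cos β)) Rp := by
  simp [candidate, lens]

/-! ### Contact radius of a type I candidate -/

/-- A point of the left sphere on the interface is a limit of `Γ₋` outside `Γ₋`, hence a boundary
point of `Γ₊`, and so lies on the right sphere. Comparing its distances to the two centres gives the
equality. -/
theorem contact_radius_eq {m : ℕ} (hm : m ≠ 0) {a R b Q r : ℝ} (hR : 0 < R) {α : ℝ}
    (hα : α ∈ Ico 0 Real.pi) (ha : a = -(R * Real.cos α)) (hr : 0 ≤ r) (hbr : b ^ 2 + r ^ 2 = Q ^ 2)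
    (h : manifoldBoundary (bdryLeft (lens m a R b Q))
      = manifoldBoundary (bdryRight (lens m a R b Q))) :
    R * Real.sin α = r := by
  obtain ⟨k, rfl⟩ := Nat.exists_eq_succ_of_ne_zero hm
  rw [Nat.succ_eq_add_one] at *
  -- A meridian of the left sphere: it reaches the interface at `τ = α` and enters the left
  -- half-space for `τ` slightly above `α`, which is possible since `α < π`.
  set p : ℝ → EuclideanSpace ℝ (Fin (k + 1 + 1)) := fun τ =>
    EuclideanSpace.single 0 (a + R * Real.cos τ) + EuclideanSpace.single 1 (R * Real.sin τ) with hp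
  have hp0 : ∀ τ, p τ 0 = a + R * Real.cos τ := by intro τ; simp [hp]
  have hps : ∀ τ, ∑ i : Fin (k + 1), p τ i.succ ^ 2 = (R * Real.sin τ) ^ 2 := by
    intro τ
    rw [Fin.sum_univ_succ, Finset.sum_eq_zero]
    · simp [hp]
    · intro i _
      have : (i.succ.succ : Fin (k + 1 + 1)) ≠ 1 := by
        simp [Fin.ext_iff]
      simp [hp, this]
  have hpsph : ∀ τ, p τ ∈ sphere (EuclideanSpace.single 0 (1 * a)) R := by
    intro τ
    rw [mem_sphere, ← sq_eq_sq₀ dist_nonneg hR.le, dist_single_sq, hps, hp0]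
    linear_combination R ^ 2 * Real.sin_sq_add_cos_sq τ
  have hopen : ∀ σ : ℝ, IsOpen {x : EuclideanSpace ℝ (Fin (k + 1 + 1)) | σ * x 0 < 0} :=
    fun σ => isOpen_lt (by fun_prop) continuous_const
  have hleft : sphere (EuclideanSpace.single 0 (1 * a)) R ∩ {x | 1 * x 0 < 0}
      ⊆ bdryLeft (lens (k + 1) a R b Q) := by
    -- Inside an open half-space the frontier depends only on the part of the set lying there.
    rw [bdryLeft, leftHalf_eq, ← frontier_inter_open_inter (hopen 1), lens_inter_leftHalf,
      frontier_inter_open_inter (hopen 1), frontier_closedBall _ hR.ne']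
  have hright : bdryRight (lens (k + 1) a R b Q) ⊆ sphere (EuclideanSpace.single 0 (-1 * b)) Q := by
    rw [bdryRight, rightHalf_eq, ← frontier_inter_open_inter (hopen (-1)), lens_inter_rightHalf,
      frontier_inter_open_inter (hopen (-1))]
    exact inter_subset_left.trans frontier_closedBall_subset_sphere
  have hcl : p α ∈ closure (bdryLeft (lens (k + 1) a R b Q)) := by
    have hcont : Continuous p := by
      have hsingle : ∀ i : Fin (k + 1 + 1), Continuous fun t : ℝ =>
          (EuclideanSpace.single i t : EuclideanSpace ℝ (Fin (k + 1 + 1))) := fun i =>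
        (PiLp.continuous_toLp 2 _).comp (continuous_single (A := fun _ => ℝ) i)
      exact ((hsingle 0).comp (by fun_prop)).add ((hsingle 1).comp (by fun_prop))
    refine mem_closure_of_tendsto ((hcont.tendsto α).mono_left nhdsWithin_le_nhds)
      (b := 𝓝[>] α) ?_
    filter_upwards [Ioo_mem_nhdsGT hα.2] with τ hτ
    refine hleft ⟨hpsph τ, ?_⟩
    rw [mem_ofPred_eq, hp0, ha]
    have := Real.cos_lt_cos_of_nonneg_of_le_pi hα.1 hτ.2.le hτ.1
    nlinarith
  have hmem : p α ∈ manifoldBoundary (bdryLeft (lens (k + 1) a R b Q)) := by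
    refine ⟨hcl, fun h' => ?_⟩
    have : p α 0 < 0 := h'.2
    rw [hp0, ha] at this
    linarith
  rw [h] at hmem
  have hs := closure_minimal hright isClosed_sphere hmem.1
  have hQ : 0 ≤ Q := by
    rw [mem_sphere] at hs
    exact hs ▸ dist_nonneg
  rw [mem_sphere, ← sq_eq_sq₀ dist_nonneg hQ, dist_single_sq, hps, hp0, ha] at hs
  rw [← sq_eq_sq₀ (mul_nonneg hR.le (Real.sin_nonneg_of_nonneg_of_le_pi hα.1 hα.2.le)) hr]
  linarith

/-- If `r = 0`, both balls touch the interface at most at the origin, whereas a disc of positive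
radius contains two points with different second coordinates. This excludes the tangent angles `α =
0` and `β = π`. -/
theorem contact_radius_pos {m : ℕ} (hm : m ≠ 0) {a R b Q r : ℝ} (hR : 0 ≤ R) (hQ : 0 ≤ Q)
    (hr : 0 ≤ r) (har : a ^ 2 + r ^ 2 = R ^ 2) (hbr : b ^ 2 + r ^ 2 = Q ^ 2)
    (h : ∃ c ∈ interface (m + 1), ∃ r : ℝ, 0 < r ∧
      closure (lens m a R b Q) ∩ interface (m + 1) = closedBall c r ∩ interface (m + 1)) :
    0 < r := by
  obtain ⟨k, rfl⟩ := Nat.exists_eq_succ_of_ne_zero hm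
  rw [Nat.succ_eq_add_one] at *
  refine hr.lt_of_ne' fun hr0 => ?_
  obtain ⟨c, hc, s, hs, heq⟩ := h
  rw [(isClosed_lens _ _ _ _ _).closure_eq] at heq
  have hc : c 0 = 0 := hc
  have key : ∀ x ∈ closedBall c s ∩ interface (k + 1 + 1), x 1 = 0 := by
    intro x hx
    rw [← heq] at hx
    have hx0 : x 0 = 0 := hx.2
    have hle : ∑ i : Fin (k + 1), x i.succ ^ 2 ≤ 0 := by
      rcases hx.1 with ⟨h, -⟩ | ⟨h, -⟩
      · rw [mem_closedBall_single _ hR, hx0] at h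
        subst hr0
        linarith
      · rw [mem_closedBall_single _ hQ, hx0] at h
        subst hr0
        linarith
    have h1 := Finset.single_le_sum (f := fun i : Fin (k + 1) => x i.succ ^ 2)
      (fun i _ => sq_nonneg _) (Finset.mem_univ 0)
    have h2 : x 1 ^ 2 ≤ 0 := h1.trans hle
    exact pow_eq_zero_iff two_ne_zero |>.1 (le_antisymm h2 (sq_nonneg _))
  have h1 := key c ⟨mem_closedBall_self hs.le, hc⟩
  have h2 := key (c + EuclideanSpace.single 1 s) ⟨by simp [abs_of_pos hs], by
    simp [interface, hc]⟩
  simp [h1] at h2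
  exact hs.ne' h2

/-! ### First variation and Snell's law -/

/-- The first-order condition for a lens that minimizes the weighted perimeter. -/
theorem snell_of_isMinimizer_lens {m : ℕ} (hm : m ≠ 0) {ρm ρp γ Vm Vp : ℝ} (hρm : 0 < ρm)
    (hρp : 0 < ρp) {R w Q v : ℝ} (hR : 0 < R) (hw : |w| < 1) (hQ : 0 < Q) (hv : |v| < 1)
    (hrad : R * √(1 - w ^ 2) = Q * √(1 - v ^ 2))
    (h : IsMinimizer ρm ρp γ Vm Vp (lens m (-(R * w)) R (-(Q * v)) Q)) :
    ρm * w + ρp * v = 0 := by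
  obtain ⟨R', w', h1, h1r, h1d⟩ := exists_cap_family hm hR hw
  obtain ⟨Q', v', h2, h2r, h2d⟩ := exists_cap_family hm hQ hv
  rw [← hrad] at h2 h2r h2d
  set r := R * √(1 - w ^ 2) with hr
  have hr0 : 0 < r := mul_pos hR
    (Real.sqrt_pos.2 (by have := (sq_lt_one_iff_abs_lt_one w).2 hw; linarith))
  have hadm := (isAdmissible_lens_iff hm hR hw hQ hv).1 h.1
  -- Both caps are moved with the same contact radius, so every competitor is again a lens without
  -- interface cost and with both volumes unchanged.
  have hmin : IsLocalMin
      (fun r => ρm * capArea m (R' r) (w' r) + ρp * capArea m (Q' r) (v' r)) r := by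
    filter_upwards [h1, h2] with s hs1 hs2
    obtain ⟨hR', hw', hrs, hV⟩ := hs1
    obtain ⟨hQ', hv', hrs', hV'⟩ := hs2
    have hT : IsAdmissible ρm ρp Vm Vp (lens m (-(R' s * w' s)) (R' s) (-(Q' s * v' s)) (Q' s)) :=
      (isAdmissible_lens_iff hm hR' hw' hQ' hv').2 (by rw [hV, hV']; exact hadm)
    have hle := h.2 _ hT
    rw [weightedPerimeter_lens hm hρm hρp hR hw hQ hv hrad,
      weightedPerimeter_lens hm hρm hρp hR' hw' hQ' hv' (hrs.trans hrs'.symm),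
      ENNReal.ofReal_le_ofReal_iff (add_nonneg (mul_nonneg hρm.le (capArea_nonneg hm hR' hw'))
        (mul_nonneg hρp.le (capArea_nonneg hm hQ' hv')))] at hle
    rw [h1r, h2r]
    exact hle
  have hz := hmin.hasDerivAt_eq_zero ((h1d.const_mul ρm).add (h2d.const_mul ρp))
  -- The area of the contact sphere, a common factor of both derivatives; it is nonzero because `r >
  -- 0`.
  have hK : unitBallVolume m * m * r ^ (m - 1) ≠ 0 :=
    mul_ne_zero (mul_ne_zero (unitBallVolume_pos m).ne' (Nat.cast_ne_zero.2 hm))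
      (pow_ne_zero _ hr0.ne')
  have hprod : (ρm * w + ρp * v) * (unitBallVolume m * m * r ^ (m - 1)) = 0 := by
    linear_combination -hz
  exact (mul_eq_zero.1 hprod).resolve_right hK

theorem snell_of_isTypeIMinimizer {m : ℕ} (hm : m ≠ 0) {ρm ρp γ Vm Vp : ℝ} (hρm : 0 < ρm)
    (hρp : 0 < ρp) {α β Rm Rp : ℝ} (hα : α ∈ Ico 0 Real.pi) (hβ : β ∈ Ioc 0 Real.pi)
    (hRm : 0 < Rm) (hRp : 0 < Rp)
    (h : IsTypeIMinimizer ρm ρp γ Vm Vp (candidate (m + 1) α β Rm Rp)) :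
    ρm * Real.cos α = ρp * Real.cos β := by
  rw [candidate_eq_lens] at h
  have hsα := Real.sin_nonneg_of_nonneg_of_le_pi hα.1 hα.2.le
  have hsβ := Real.sin_nonneg_of_nonneg_of_le_pi hβ.1.le hβ.2
  have hα2 := Real.sin_sq_add_cos_sq α
  have hβ2 := Real.sin_sq_add_cos_sq β
  have hbr : (-(Rp * -Real.cos β)) ^ 2 + (Rp * Real.sin β) ^ 2 = Rp ^ 2 := by
    linear_combination Rp ^ 2 * hβ2
  have hrad := contact_radius_eq hm hRm hα rfl (mul_nonneg hRp.le hsβ) hbr h.boundary_eq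
  have hpos := contact_radius_pos hm hRm.le hRp.le (mul_nonneg hRp.le hsβ)
    (by rw [← hrad]; linear_combination Rm ^ 2 * hα2) hbr h.ball_interface
  have hsβ' : 0 < Real.sin β := pos_of_mul_pos_right hpos hRp.le
  have hsα' : 0 < Real.sin α := pos_of_mul_pos_right (hrad ▸ hpos) hRm.le
  have hw : |Real.cos α| < 1 := (sq_lt_one_iff_abs_lt_one _).1 (by nlinarith)
  have hv : |-Real.cos β| < 1 := (sq_lt_one_iff_abs_lt_one _).1 (by nlinarith)
  have e1 : √(1 - Real.cos α ^ 2) = Real.sin α := by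
    rw [← Real.sin_sq, Real.sqrt_sq hsα]
  have e2 : √(1 - (-Real.cos β) ^ 2) = Real.sin β := by
    rw [neg_sq, ← Real.sin_sq, Real.sqrt_sq hsβ]
  have := snell_of_isMinimizer_lens hm hρm hρp hRm hw hRp hv (by rw [e1, e2, hrad]) h.isMinimizer
  linarith

end TwoPhase

theorem mainTheorem5 {N : ℕ} [NeZero N] (hN : 2 ≤ N)
    (ρm ρp γ Vm Vp : ℝ) (hρm : 0 < ρm) (hρp : 0 < ρp) (hγ : 0 ≤ γ) (hVm : 0 < Vm) (hVp : 0 < Vp)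
    (α β Rm Rp : ℝ) (hα : α ∈ Set.Ico 0 Real.pi) (hβ : β ∈ Set.Ioc 0 Real.pi)
    (hRm : 0 < Rm) (hRp : 0 < Rp)
    (h : TwoPhase.IsTypeIMinimizer ρm ρp γ Vm Vp (TwoPhase.candidate N α β Rm Rp)) :
    ρm * Real.cos α = ρp * Real.cos β := by
  obtain ⟨m, rfl⟩ := Nat.exists_eq_add_of_le' (one_le_two.trans hN)
  exact TwoPhase.snell_of_isTypeIMinimizer (by omega) hρm hρp hα hβ hRm hRp h
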